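/- Let $\mathcal H f(x)=\frac1\pi\,\mathrm{P.V.}\!\int_{\mathbb R}\frac{f(y)}{x-y}\,dy$ be the Hilbert transform and $\Lambda=(-\partial_{xx})^{1/2}=\mathcal H\partial_x$ on $\mathbb R$. Consider $$B_t-\Lambda B\,B_x+\Lambda B=0,\qquad B(x,0)=B_0(x),\qquad x\in\mathbb R. \tag{1}$$ Let $B_0\in L^2(\mathbb R)\cap C^3(\mathbb R)$ and suppose that for some $x_0\in\mathbb R$ $$\partial_xB_0(x_0)=1,\qquad \partial_{xx}B_0(x_0)=0,\qquad a:=\Lambda\partial_xB_0(x_0)>0 .$$ Put $T=1/a$. Let $\tau>0$ and let $B\in C([0,\tau);H^3(\mathbb R))$ be a solution of (1) on $[0,\tau)$, differentiable in $t$ and satisfying the equation at every point of $\mathbb R\times(0,\tau)$ (so that, in particular, $B_0\in H^3(\mathbb R)$; no further decay of $B_0$ is assumed). Then: 1. $\tau\le T$; that is, no such solution exists beyond the finite time $T$. 2. The trajectory problem $X'(t)=-\Lambda B(X(t),t)$, $X(0)=x_0$ has a solution on $[0,\tau)$, and along every solution $X$ the quantity $\Lambda B_x=\mathcal H B_{xx}$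 satisfies the Riccati equation $\frac{d}{dt}\,\Lambda B_x(X(t),t)=\big(\Lambda B_x(X(t),t)\big)^2$ for $0<t<\tau$, and $$\Lambda B_x(X(t),t)=\frac{a}{1-ta}\qquad (0\le t<\tau).$$ 3. If the solution exists up to $T$, i.e. $\tau=T$, then $\Lambda B_x(X(t),t)\to+\infty$ as $t\uparrow T$. -/

import Mathlib

open Set Filter Topology MeasureTheory

noncomputable section

namespace EMHD

/-- The Hilbert transform `ℋ f (x) = (1/π) P.V. ∫ f(y) / (x - y) dy`, the principal value being the
limit as `ε ↓ 0` of the integrals over `|x - y| > ε`. (For a Hölder continuous `f` in `L²` the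
truncated integrals converge absolutely and the limit exists at every point.) -/
def hilbert (f : ℝ → ℝ) (x : ℝ) : ℝ :=
  limUnder (𝓝[>] (0 : ℝ)) fun ε : ℝ =>
    (1 / Real.pi) * ∫ y in {y : ℝ | ε < |x - y|}, f y / (x - y)

/-- The operator `Λ = (-∂ₓₓ)^{1/2} = ℋ ∂ₓ` on the real line. -/
def Lam (f : ℝ → ℝ) : ℝ → ℝ := hilbert (deriv f)

/-- The Sobolev space `H³(ℝ)` (continuous representatives): `f` is of class `C²`, its second
derivative is the primitive of its almost everywhere defined third derivative, and `f` and its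
derivatives up to order three are square integrable. -/
structure MemH3 (f : ℝ → ℝ) : Prop where
  contDiff : ContDiff ℝ 2 f
  memLp : ∀ k ≤ 3, MemLp (iteratedDeriv k f) 2 volume
  integral_third : ∀ a b : ℝ,
    ∫ x in a..b, iteratedDeriv 3 f x = iteratedDeriv 2 f b - iteratedDeriv 2 f a

/-- `B t x` is a solution on the time interval `[0, τ)`, in the class `C([0, τ); H³(ℝ))`, of
`B_t - ΛB B_x + ΛB = 0` with initial data `B₀`; the equation holds at every point of
`(0, τ) × ℝ`. -/
structure IsSolution (B : ℝ → ℝ → ℝ) (τ : ℝ) (B₀ : ℝ → ℝ) : Prop where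
  memH3 : ∀ t ∈ Ico 0 τ, MemH3 (B t)
  continuous_H3 : ∀ t ∈ Ico 0 τ, ∀ k ≤ 3,
    Tendsto (fun s => eLpNorm (iteratedDeriv k (B s) - iteratedDeriv k (B t)) 2 volume)
      (𝓝[Ico 0 τ] t) (𝓝 0)
  initial : B 0 = B₀
  equation : ∀ t ∈ Ioo 0 τ, ∀ x : ℝ, ∃ Bt : ℝ,
    HasDerivAt (fun s => B s x) Bt t ∧
      Bt - Lam (B t) x * deriv (B t) x + Lam (B t) x = 0

/-- `X` is the trajectory from `x₀` on `[0, τ)`: `X' = -ΛB(X, t)`, `X(0) = x₀`. -/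
structure IsTrajectory (B : ℝ → ℝ → ℝ) (τ x₀ : ℝ) (X : ℝ → ℝ) : Prop where
  initial : X 0 = x₀
  ode : ∀ t ∈ Ico 0 τ, HasDerivWithinAt X (-Lam (B t) (X t)) (Ico 0 τ) t

end EMHD

end

/-!
The `x`-derivative of `B_t = ΛB (B_x - 1)` is the imaginary part of a complex Burgers equation. Put
`U = ΛB - i (B_x - 1) = ℋ f - i (f - 1)` with `f = B_x`. Since `ℋ² = -1` and
`ℋ (f ℋ f) = ((ℋ f) ^ 2 - f ^ 2) / 2`, the equation becomes `U_t = U U_x` on the real line. At the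
point `x₀` the value `U` is the real number `c = ΛB₀ x₀`, so its characteristic is the straight
line `x₀ - c t` in the real axis. On it `U = c`, which makes the line the trajectory of `x₀`, and
`U_x = ΛB_x - i B_xx` solves `q' = q ^ 2` with the real initial value `a`. Hence
`ΛB_x = a / (1 - a t)` along the line, which rules out a solution beyond time `1 / a`.

In the class `C([0, τ); H³)` the functions `U` and `U_x` are continuous, but `U_xx` need not be, and
the equation for `U_t` is not available directly because `ℋ` and `∂ₜ` have to be exchanged.
Both points are handled as follows.

* The principal value is folded into the absolutely convergent integral `foldedHilbert`, bounded
  uniformly by the `H¹` norm.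
* The equation is paired with the kernel `(z - y)⁻¹ ^ 2`, `Im z > 0`, under which differentiation
  in time is legitimate (`IsSolution.hasDerivAt_cauchyTwo`). The two identities for `ℋ` become
  identities for Cauchy integrals, proved by Fubini's theorem and partial fractions
  (`integral_mul_foldedHilbert_mul_inv_sub_sq`, `integral_inv_sub_sq_mul_foldedHilbert`), and yield
  complex Burgers in the upper half plane (`IsSolution.hasDerivAt_cauchyOne`).
* Letting `Im z` tend to `0` (`tendsto_cauchyOne`) gives complex Burgers on the real line,
  integrated in time (`IsSolution.boundaryValue_sub_eq`).
* The Riccati equation for `U_x` is the limit of the linear equations satisfied by the difference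
  quotients of `U` in the frame moving along the characteristic (`IsBurgers.riccati`).
-/

namespace EMHD

/-! ### Square integrable functions and `H¹` on the line -/

lemma toReal_eLpNorm_two {μ : Measure ℝ} {f : ℝ → ℝ} (hf : MemLp f 2 μ) :
    (eLpNorm f 2 μ).toReal = √(∫ x, f x ^ 2 ∂μ) := by
  rw [hf.eLpNorm_eq_integral_rpow_norm (by norm_num) (by norm_num),
    ENNReal.toReal_ofReal (by positivity), Real.sqrt_eq_rpow]
  simp

lemma integrable_mul_of_memLp {μ : Measure ℝ} {f g : ℝ → ℝ} (hf : MemLp f 2 μ)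
    (hg : MemLp g 2 μ) : Integrable (fun x => f x * g x) μ :=
  MemLp.integrable_mul hf hg

lemma integral_abs_mul_abs_le {μ : Measure ℝ} {f g : ℝ → ℝ} (hf : MemLp f 2 μ)
    (hg : MemLp g 2 μ) :
    ∫ x, |f x| * |g x| ∂μ ≤ (eLpNorm f 2 μ).toReal * (eLpNorm g 2 μ).toReal := by
  have h := integral_mul_norm_le_Lp_mul_Lq (μ := μ) (f := f) (g := g) Real.HolderConjugate.two_two
    (by simpa using hf) (by simpa using hg)
  rw [toReal_eLpNorm_two hf, toReal_eLpNorm_two hg, Real.sqrt_eq_rpow, Real.sqrt_eq_rpow]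
  simpa using h

/-- The `L²(ℝ)` norm as a real number. -/
noncomputable def nrm (f : ℝ → ℝ) : ℝ := (eLpNorm f 2 volume).toReal

lemma nrm_nonneg (f : ℝ → ℝ) : 0 ≤ nrm f := ENNReal.toReal_nonneg

lemma toReal_eLpNorm_restrict_le {f : ℝ → ℝ} (hf : MemLp f 2 volume) (S : Set ℝ) :
    (eLpNorm f 2 (volume.restrict S)).toReal ≤ nrm f :=
  ENNReal.toReal_mono hf.2.ne (eLpNorm_restrict_le f 2 volume S)

lemma setIntegral_abs_mul_abs_le {f g : ℝ → ℝ} (hf : MemLp f 2 volume) {S : Set ℝ}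
    (hg : MemLp g 2 (volume.restrict S)) :
    ∫ x in S, |f x| * |g x| ≤ nrm f * √(∫ x in S, g x ^ 2) := by
  refine (integral_abs_mul_abs_le (hf.mono_measure Measure.restrict_le_self) hg).trans ?_
  rw [← toReal_eLpNorm_two hg]
  exact mul_le_mul_of_nonneg_right (toReal_eLpNorm_restrict_le hf S) ENNReal.toReal_nonneg

lemma memLp_comp_sub {f : ℝ → ℝ} (hf : MemLp f 2 volume) (x : ℝ) :
    MemLp (fun s => f (x - s)) 2 volume :=
  hf.comp_measurePreserving (Measure.measurePreserving_sub_left volume x)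

lemma memLp_comp_add {f : ℝ → ℝ} (hf : MemLp f 2 volume) (x : ℝ) :
    MemLp (fun s => f (x + s)) 2 volume :=
  hf.comp_measurePreserving (measurePreserving_add_left volume x)

lemma nrm_comp_sub {f : ℝ → ℝ} (hf : MemLp f 2 volume) (x : ℝ) :
    nrm (fun s => f (x - s)) = nrm f := by
  unfold nrm
  congr 1
  exact eLpNorm_comp_measurePreserving hf.1 (Measure.measurePreserving_sub_left volume x)

lemma nrm_comp_add {f : ℝ → ℝ} (hf : MemLp f 2 volume) (x : ℝ) :
    nrm (fun s => f (x + s)) = nrm f := by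
  unfold nrm
  congr 1
  exact eLpNorm_comp_measurePreserving hf.1 (measurePreserving_add_left volume x)

/-- `f ∈ H¹(ℝ)` is the continuous representative, with weak derivative `f'`: both functions are
square integrable and `f` is a primitive of `f'`. -/
structure IsH1 (f f' : ℝ → ℝ) : Prop where
  cont : Continuous f
  memLp : MemLp f 2 volume
  memLp' : MemLp f' 2 volume
  ftc : ∀ a b : ℝ, ∫ x in a..b, f' x = f b - f a

lemma memLp_one_restrict {S : Set ℝ} (hS : volume S ≠ ⊤) :
    MemLp (fun _ : ℝ => (1 : ℝ)) 2 (volume.restrict S) := by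
  have : IsFiniteMeasure (volume.restrict S) := ⟨by simpa using hS.lt_top⟩
  exact memLp_const 1

lemma setIntegral_Ioc_abs_le {f : ℝ → ℝ} (hf : MemLp f 2 volume) {a b : ℝ} (hab : a ≤ b) :
    ∫ x in Ioc a b, |f x| ≤ √(b - a) * nrm f := by
  have h := setIntegral_abs_mul_abs_le hf (S := Ioc a b) (memLp_one_restrict (by simp))
  simp only [abs_one, mul_one, one_pow] at h
  simpa [mul_comm, Measure.real, hab] using h

namespace IsH1

variable {f f' : ℝ → ℝ}

/-- Functions in `H¹(ℝ)` are Hölder continuous of exponent `1/2`. -/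
lemma abs_sub_le (h : IsH1 f f') {x y : ℝ} (hxy : x ≤ y) :
    |f y - f x| ≤ √(y - x) * nrm f' := by
  rw [← h.ftc, intervalIntegral.integral_of_le hxy]
  exact abs_integral_le_integral_abs.trans (setIntegral_Ioc_abs_le h.memLp' hxy)

lemma abs_le (h : IsH1 f f') (x : ℝ) : |f x| ≤ nrm f + nrm f' := by
  have h1 : ∀ y ∈ Ioc x (x + 1), |f x| - nrm f' ≤ |f y| := by
    intro y hy
    have h2 := h.abs_sub_le hy.1.le
    have h3 : √(y - x) ≤ 1 := by
      rw [Real.sqrt_le_one]; linarith [hy.2]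
    have h4 : √(y - x) * nrm f' ≤ nrm f' :=
      mul_le_of_le_one_left (nrm_nonneg _) h3
    have h5 := abs_sub_abs_le_abs_sub (f x) (f y)
    rw [abs_sub_comm] at h5
    linarith
  have h2 := setIntegral_Ioc_abs_le h.memLp (show x ≤ x + 1 by linarith)
  have h3 : ∫ _ in Ioc x (x + 1), (|f x| - nrm f') ≤ ∫ y in Ioc x (x + 1), |f y| :=
    setIntegral_mono_on (by simp) (h.cont.abs.integrableOn_Ioc) measurableSet_Ioc h1
  simp at h2 h3
  linarith

lemma sub {g g' : ℝ → ℝ} (h : IsH1 f f') (hg : IsH1 g g') : IsH1 (f - g) (f' - g') where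
  cont := h.cont.sub hg.cont
  memLp := h.memLp.sub hg.memLp
  memLp' := h.memLp'.sub hg.memLp'
  ftc a b := by
    have i1 : ∀ {u : ℝ → ℝ}, MemLp u 2 volume → IntervalIntegrable u volume a b := fun hu =>
      ((hu.locallyIntegrable (by norm_num)).integrableOn_isCompact
        isCompact_uIcc).intervalIntegrable
    simp only [Pi.sub_apply]
    rw [intervalIntegral.integral_sub (i1 h.memLp') (i1 hg.memLp'), h.ftc, hg.ftc]
    ring

/-! ### The Hilbert transform as an absolutely convergent integral -/

lemma abs_diff_div_le (h : IsH1 f f') (x : ℝ) {s : ℝ} (hs : 0 < s) :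
    |(f (x - s) - f (x + s)) / s| ≤ (√2 * nrm f') * s ^ (-(1 / 2) : ℝ) := by
  have h1 := h.abs_sub_le (show x - s ≤ x + s by linarith)
  rw [abs_sub_comm, show x + s - (x - s) = 2 * s by ring, Real.sqrt_mul (by norm_num)] at h1
  rw [abs_div, abs_of_pos hs, div_le_iff₀ hs]
  refine h1.trans (le_of_eq ?_)
  rw [mul_assoc _ _ s, ← Real.rpow_add_one hs.ne', Real.sqrt_eq_rpow]
  norm_num
  rw [Real.sqrt_eq_rpow]
  ring

lemma measurable_diff_div (h : IsH1 f f') (x : ℝ) :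
    Measurable (fun s => (f (x - s) - f (x + s)) / s) :=
  ((h.cont.measurable.comp (measurable_const.sub measurable_id)).sub
    (h.cont.measurable.comp (measurable_const.add measurable_id))).div measurable_id

end IsH1

lemma integrableOn_rpow_neg_half : IntegrableOn (fun s : ℝ => s ^ (-(1 / 2) : ℝ)) (Ioc 0 1) := by
  have := (intervalIntegral.intervalIntegrable_rpow' (a := (0 : ℝ)) (b := 1)
    (show (-1 : ℝ) < -(1 / 2) by norm_num))
  rwa [intervalIntegrable_iff_integrableOn_Ioc_of_le zero_le_one] at this

lemma integral_rpow_neg_half : ∫ s in Ioc (0 : ℝ) 1, s ^ (-(1 / 2) : ℝ) = 2 := by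
  rw [← intervalIntegral.integral_of_le zero_le_one, integral_rpow (Or.inl (by norm_num))]
  norm_num

lemma integrableOn_inv_sq {a : ℝ} (ha : 0 < a) : IntegrableOn (fun s : ℝ => s⁻¹ ^ 2) (Ioi a) := by
  refine (integrableOn_Ioi_rpow_of_lt (show (-2 : ℝ) < -1 by norm_num) ha).congr_fun ?_
    measurableSet_Ioi
  intro s hs
  have hs0 : 0 < s := ha.trans hs
  simp only
  rw [show (-2 : ℝ) = -((2 : ℕ) : ℝ) by norm_num, Real.rpow_neg hs0.le, Real.rpow_natCast, inv_pow]

lemma integral_inv_sq : ∫ s in Ioi (1 : ℝ), s⁻¹ ^ 2 = 1 := by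
  have h := integral_Ioi_rpow_of_lt (show (-2 : ℝ) < -1 by norm_num) (zero_lt_one : (0 : ℝ) < 1)
  norm_num at h
  simpa only [inv_pow] using h

lemma memLp_inv {a : ℝ} (ha : 0 < a) :
    MemLp (fun s : ℝ => s⁻¹) 2 (volume.restrict (Ioi a)) :=
  (memLp_two_iff_integrable_sq measurable_inv.aestronglyMeasurable).2 (integrableOn_inv_sq ha)

lemma integrableOn_diff_div_Ioi {f : ℝ → ℝ} (hf : MemLp f 2 volume) (x : ℝ) {a : ℝ} (ha : 0 < a) :
    IntegrableOn (fun s => f (x - s) / s) (Ioi a) ∧ IntegrableOn (fun s => f (x + s) / s) (Ioi a) :=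
  ⟨integrable_mul_of_memLp ((memLp_comp_sub hf x).mono_measure Measure.restrict_le_self)
    (memLp_inv ha), integrable_mul_of_memLp ((memLp_comp_add hf x).mono_measure
      Measure.restrict_le_self) (memLp_inv ha)⟩

namespace IsH1

variable {f f' : ℝ → ℝ}

lemma integrableOn_diff_div (h : IsH1 f f') (x : ℝ) :
    IntegrableOn (fun s => (f (x - s) - f (x + s)) / s) (Ioi 0) := by
  rw [← Ioc_union_Ioi_eq_Ioi (zero_le_one : (0 : ℝ) ≤ 1)]
  refine IntegrableOn.union ?_ ?_
  · refine Integrable.mono' (integrableOn_rpow_neg_half.const_mul (√2 * nrm f'))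
      (h.measurable_diff_div x).aestronglyMeasurable ?_
    filter_upwards [ae_restrict_mem measurableSet_Ioc] with s hs
    exact h.abs_diff_div_le x hs.1
  · have := integrableOn_diff_div_Ioi h.memLp x zero_lt_one
    simp only [sub_div]; exact this.1.sub this.2

/-- The folded kernel of the Hilbert transform is absolutely integrable, uniformly in the point:
near `0` by Hölder continuity, at infinity by the Cauchy–Schwarz inequality. -/
lemma integral_abs_diff_div_le (h : IsH1 f f') (x : ℝ) :
    ∫ s in Ioi 0, |(f (x - s) - f (x + s)) / s| ≤ 2 * nrm f + 3 * nrm f' := by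
  have hi : IntegrableOn (fun s => |(f (x - s) - f (x + s)) / s|) (Ioi 0) :=
    (h.integrableOn_diff_div x).abs
  rw [← Ioc_union_Ioi_eq_Ioi (zero_le_one : (0 : ℝ) ≤ 1)] at hi ⊢
  rw [setIntegral_union (Ioc_disjoint_Ioi le_rfl) measurableSet_Ioi hi.left_of_union
    hi.right_of_union]
  have h1 : ∫ s in Ioc (0 : ℝ) 1, |(f (x - s) - f (x + s)) / s| ≤ 3 * nrm f' := by
    calc _ ≤ ∫ s in Ioc (0 : ℝ) 1, (√2 * nrm f') * s ^ (-(1 / 2) : ℝ) :=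
          setIntegral_mono_on hi.left_of_union (integrableOn_rpow_neg_half.const_mul _)
            measurableSet_Ioc fun s hs => h.abs_diff_div_le x hs.1
      _ = (2 * √2) * nrm f' := by
          rw [integral_const_mul, integral_rpow_neg_half]; ring
      _ ≤ 3 * nrm f' := by
          refine mul_le_mul_of_nonneg_right ?_ (nrm_nonneg _)
          have : √2 ≤ 3 / 2 := Real.sqrt_le_iff.2 ⟨by norm_num, by norm_num⟩
          linarith
  have h2 : ∫ s in Ioi (1 : ℝ), |(f (x - s) - f (x + s)) / s| ≤ 2 * nrm f := by
    have ha := setIntegral_abs_mul_abs_le (memLp_comp_sub h.memLp x) (memLp_inv zero_lt_one)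
    have hb := setIntegral_abs_mul_abs_le (memLp_comp_add h.memLp x) (memLp_inv zero_lt_one)
    rw [nrm_comp_sub h.memLp, integral_inv_sq, Real.sqrt_one, mul_one] at ha
    rw [nrm_comp_add h.memLp, integral_inv_sq, Real.sqrt_one, mul_one] at hb
    have i := integrableOn_diff_div_Ioi h.memLp x zero_lt_one
    have ia : IntegrableOn (fun s => |f (x - s)| * |s⁻¹|) (Ioi 1) := by
      simp only [← abs_mul, ← div_eq_mul_inv]; exact i.1.abs
    have ib : IntegrableOn (fun s => |f (x + s)| * |s⁻¹|) (Ioi 1) := by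
      simp only [← abs_mul, ← div_eq_mul_inv]; exact i.2.abs
    calc _ ≤ ∫ s in Ioi (1 : ℝ), (|f (x - s)| * |s⁻¹| + |f (x + s)| * |s⁻¹|) := by
          refine setIntegral_mono_on hi.right_of_union (ia.add ib) measurableSet_Ioi fun s _ => ?_
          rw [div_eq_mul_inv, abs_mul, ← add_mul]
          exact mul_le_mul_of_nonneg_right (abs_sub _ _) (abs_nonneg _)
      _ ≤ _ := by rw [integral_add ia ib]; linarith
  linarith

end IsH1

/-- `π` times the Hilbert transform, with the principal value folded into the integral
`∫₀^∞ (f (x - s) - f (x + s)) / s ds`, which converges absolutely for `f ∈ H¹(ℝ)`. -/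
noncomputable def foldedHilbert (f : ℝ → ℝ) (x : ℝ) : ℝ :=
  ∫ s in Ioi 0, (f (x - s) - f (x + s)) / s

namespace IsH1

variable {f f' : ℝ → ℝ}

lemma abs_foldedHilbert_le (h : IsH1 f f') (x : ℝ) :
    |foldedHilbert f x| ≤ 2 * nrm f + 3 * nrm f' :=
  abs_integral_le_integral_abs.trans (h.integral_abs_diff_div_le x)

lemma foldedHilbert_sub {g g' : ℝ → ℝ} (h : IsH1 f f') (hg : IsH1 g g') (x : ℝ) :
    foldedHilbert (f - g) x = foldedHilbert f x - foldedHilbert g x := by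
  unfold foldedHilbert
  rw [← integral_sub (h.integrableOn_diff_div x) (hg.integrableOn_diff_div x)]
  congr 1; ext s; simp only [Pi.sub_apply]; ring

lemma truncated_eq (h : IsH1 f f') (x : ℝ) {ε : ℝ} (hε : 0 < ε) :
    ∫ y in {y : ℝ | ε < |x - y|}, f y / (x - y) = ∫ s in Ioi ε, (f (x - s) - f (x + s)) / s := by
  have e1 : ∫ y in {y : ℝ | ε < |x - y|}, f y / (x - y) =
      ∫ s in {s : ℝ | ε < |s|}, f (x - s) / s := by
    have := (Measure.measurePreserving_sub_left volume x).setIntegral_preimage_emb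
      (MeasurableEquiv.subLeft x).measurableEmbedding (fun s => f (x - s) / s) {s : ℝ | ε < |s|}
    simpa using this
  have e2 : {s : ℝ | ε < |s|} = Iio (-ε) ∪ Ioi ε := by
    ext s; simp only [mem_ofPred_eq, lt_abs, mem_union, mem_Iio, mem_Ioi]
    constructor
    · rintro (h | h); · exact Or.inr h
      · left; linarith
    · rintro (h | h); · right; linarith
      · exact Or.inl h
  have i := integrableOn_diff_div_Ioi h.memLp x hε
  have e3 : ∫ s in Iio (-ε), f (x - s) / s = ∫ s in Ioi ε, -(f (x + s) / s) := by
    rw [← integral_Iic_eq_integral_Iio, ← integral_comp_neg_Ioi]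
    simp [div_neg]
  have i3 : IntegrableOn (fun s => f (x - s) / s) (Iio (-ε)) := by
    have : IntegrableOn (fun s => -(f (x + s) / s)) (Ioi (- -ε)) := by simpa using i.2.neg
    simpa [div_neg, ← sub_eq_add_neg] using this.comp_neg_Iio
  rw [e1, e2, setIntegral_union (by
    rw [Set.disjoint_left]; intro s hs hs'; simp only [mem_Iio, mem_Ioi] at hs hs'; linarith)
    measurableSet_Ioi i3 i.1, e3, integral_neg]
  simp only [sub_div]
  rw [integral_sub i.1 i.2]; ring

/-- The principal value exists and is the folded integral. -/
lemma hilbert_eq (h : IsH1 f f') (x : ℝ) : hilbert f x = foldedHilbert f x / Real.pi := by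
  have hc : Tendsto (fun ε => ∫ s in Ioi ε, (f (x - s) - f (x + s)) / s) (𝓝[>] 0)
      (𝓝 (foldedHilbert f x)) := by
    have hcov : AECover (volume.restrict (Ioi (0 : ℝ))) (𝓝[>] 0) fun ε : ℝ => Ioi ε :=
      aecover_Ioi_of_Ioi (tendsto_nhdsWithin_of_tendsto_nhds tendsto_id)
    refine (hcov.integral_tendsto_of_countably_generated (h.integrableOn_diff_div x)).congr' ?_
    filter_upwards [self_mem_nhdsWithin] with ε hε
    rw [Measure.restrict_restrict measurableSet_Ioi, Ioi_inter_Ioi, sup_eq_left.2 (le_of_lt hε)]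
  have := (hc.const_mul (1 / Real.pi))
  unfold hilbert
  rw [Tendsto.limUnder_eq (this.congr' ?_)]
  · ring
  · filter_upwards [self_mem_nhdsWithin] with ε hε
    rw [h.truncated_eq x hε]

lemma hasDerivAt (h : IsH1 f f') (hf' : Continuous f') (x : ℝ) : HasDerivAt f (f' x) x := by
  have h1 : f = fun y => f 0 + ∫ s in (0 : ℝ)..y, f' s := by
    ext y; rw [h.ftc]; ring
  rw [h1]
  exact (intervalIntegral.integral_hasDerivAt_right (hf'.intervalIntegrable _ _)
    hf'.aestronglyMeasurable.stronglyMeasurableAtFilter hf'.continuousAt).const_add _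

/-- Integration by parts in the far part of the integral, which trades the slowly decaying kernel
`1 / s` for `1 / s ^ 2`. -/
lemma foldedHilbert_eq_of_primitive {F : ℝ → ℝ} (hF : IsH1 F f) (h : IsH1 f f') (x : ℝ) :
    foldedHilbert f x = (∫ s in Ioc 0 1, (f (x - s) - f (x + s)) / s) +
      (F (x - 1) + F (x + 1) - ∫ s in Ioi 1, (F (x - s) + F (x + s)) * s⁻¹ ^ 2) := by
  have hi := h.integrableOn_diff_div x
  have hFm : Measurable fun s => F (x - s) + F (x + s) := by
    have := hF.cont
    fun_prop
  have hF2 : ∀ s, |F (x - s) + F (x + s)| ≤ 2 * (nrm F + nrm f) := fun s =>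
    (abs_add_le _ _).trans (by linarith [hF.abs_le (x - s), hF.abs_le (x + s)])
  have hi2 : IntegrableOn (fun s => (F (x - s) + F (x + s)) * s⁻¹ ^ 2) (Ioi 1) :=
    (integrableOn_inv_sq zero_lt_one).bdd_mul hFm.aestronglyMeasurable
      (ae_of_all _ hF2)
  unfold foldedHilbert
  rw [← Ioc_union_Ioi_eq_Ioi (zero_le_one : (0 : ℝ) ≤ 1)] at hi ⊢
  rw [setIntegral_union (Ioc_disjoint_Ioi le_rfl) measurableSet_Ioi hi.left_of_union
    hi.right_of_union]
  congr 1
  rw [eq_sub_iff_add_eq, ← integral_add hi.right_of_union hi2]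
  have hd : ∀ s ∈ Ioi (1 : ℝ), HasDerivAt (fun s => -((F (x - s) + F (x + s)) * s⁻¹))
      ((f (x - s) - f (x + s)) / s + (F (x - s) + F (x + s)) * s⁻¹ ^ 2) s := by
    intro s hs
    have hs0 : s ≠ 0 := (zero_lt_one.trans hs).ne'
    have d1 : HasDerivAt (fun s => F (x - s)) (-f (x - s)) s := by
      simpa using (hF.hasDerivAt h.cont (x - s)).comp_const_sub x s
    have d2 : HasDerivAt (fun s => F (x + s)) (f (x + s)) s :=
      (hF.hasDerivAt h.cont (x + s)).comp_const_add x s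
    refine ((d1.add d2).mul (hasDerivAt_inv hs0)).neg.congr_deriv ?_
    simp only [Pi.add_apply]
    field_simp
    ring
  have ht : Tendsto (fun s => -((F (x - s) + F (x + s)) * s⁻¹)) atTop (𝓝 0) := by
    refine squeeze_zero_norm (a := fun s => (2 * (nrm F + nrm f)) * |s⁻¹|) (fun s => ?_) ?_
    · rw [norm_neg, norm_mul, Real.norm_eq_abs, Real.norm_eq_abs]
      exact mul_le_mul_of_nonneg_right (hF2 s) (abs_nonneg _)
    · simpa using (tendsto_inv_atTop_zero (𝕜 := ℝ)).abs.const_mul (2 * (nrm F + nrm f))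
  have hc : ContinuousWithinAt (fun s => -((F (x - s) + F (x + s)) * s⁻¹)) (Ici 1) 1 := by
    have := hF.cont
    have : ContinuousAt (fun s => -((F (x - s) + F (x + s)) * s⁻¹)) 1 := by
      refine ContinuousAt.neg (ContinuousAt.mul (by fun_prop) (continuousAt_inv₀ one_ne_zero))
    exact this.continuousWithinAt
  rw [integral_Ioi_of_hasDerivAt_of_tendsto hc hd (hi.right_of_union.add hi2) ht]
  simp

lemma continuous_foldedHilbert {F : ℝ → ℝ} (hF : IsH1 F f) (h : IsH1 f f') :
    Continuous (foldedHilbert f) := by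
  have cF := hF.cont
  have cf := h.cont
  rw [show foldedHilbert f = _ from funext fun x => foldedHilbert_eq_of_primitive hF h x]
  refine Continuous.add ?_ ((by fun_prop : Continuous fun x => F (x - 1) + F (x + 1)).sub ?_)
  · refine continuous_of_dominated (bound := fun s => (√2 * nrm f') * s ^ (-(1 / 2) : ℝ))
      (fun x => (h.measurable_diff_div x).aestronglyMeasurable) (fun x => ?_)
      (integrableOn_rpow_neg_half.const_mul _) (ae_of_all _ fun s => by fun_prop)
    filter_upwards [ae_restrict_mem measurableSet_Ioc] with s hs
    exact h.abs_diff_div_le x hs.1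
  · refine continuous_of_dominated (bound := fun s => (2 * (nrm F + nrm f)) * s⁻¹ ^ 2)
      (fun x => ?_) (fun x => ae_of_all _ fun s => ?_)
      ((integrableOn_inv_sq zero_lt_one).const_mul _) (ae_of_all _ fun s => by fun_prop)
    · exact Measurable.aestronglyMeasurable (by fun_prop)
    · rw [norm_mul, Real.norm_eq_abs, Real.norm_eq_abs, abs_of_nonneg (sq_nonneg s⁻¹)]
      exact mul_le_mul_of_nonneg_right ((abs_add_le _ _).trans
        (by linarith [hF.abs_le (x - s), hF.abs_le (x + s)])) (sq_nonneg _)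

/-- The Hilbert transform commutes with differentiation, in integrated form. -/
lemma foldedHilbert_sub_eq {f'' : ℝ → ℝ} (h : IsH1 f f') (h' : IsH1 f' f'') (a b : ℝ) :
    foldedHilbert f b - foldedHilbert f a = ∫ x in a..b, foldedHilbert f' x := by
  have cf' := h'.cont
  have hint : Integrable (Function.uncurry fun x s => (f' (x - s) - f' (x + s)) / s)
      ((volume.restrict (uIoc a b)).prod (volume.restrict (Ioi 0))) := by
    have hm : Measurable (Function.uncurry fun x s : ℝ => (f' (x - s) - f' (x + s)) / s) := by
      unfold Function.uncurry; fun_prop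
    rw [integrable_prod_iff hm.aestronglyMeasurable]
    refine ⟨ae_of_all _ fun x => h'.integrableOn_diff_div x, ?_⟩
    have : IsFiniteMeasure (volume.restrict (uIoc a b)) := ⟨by simp [uIoc]⟩
    refine Integrable.of_bound (C := 2 * nrm f' + 3 * nrm f'')
      hm.norm.stronglyMeasurable.integral_prod_right.aestronglyMeasurable (ae_of_all _ fun x => ?_)
    rw [Real.norm_of_nonneg (integral_nonneg fun _ => norm_nonneg _)]
    exact h'.integral_abs_diff_div_le x
  unfold foldedHilbert
  rw [intervalIntegral_integral_swap hint,
    ← integral_sub (h.integrableOn_diff_div b) (h.integrableOn_diff_div a)]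
  refine setIntegral_congr_fun measurableSet_Ioi fun s _ => ?_
  rw [intervalIntegral.integral_div, intervalIntegral.integral_sub
    ((by fun_prop : Continuous fun x => f' (x - s)).intervalIntegrable _ _)
    ((by fun_prop : Continuous fun x => f' (x + s)).intervalIntegrable _ _),
    intervalIntegral.integral_comp_sub_right, intervalIntegral.integral_comp_add_right,
    h.ftc, h.ftc]
  ring

lemma hasDerivAt_foldedHilbert {f'' : ℝ → ℝ} (h : IsH1 f f') (h' : IsH1 f' f'') (x : ℝ) :
    HasDerivAt (foldedHilbert f) (foldedHilbert f' x) x := by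
  have hc := h.continuous_foldedHilbert h'
  have h1 : foldedHilbert f =
      fun y => foldedHilbert f 0 + ∫ s in (0 : ℝ)..y, foldedHilbert f' s := by
    ext y; rw [← h.foldedHilbert_sub_eq h']; ring
  rw [h1]
  exact (intervalIntegral.integral_hasDerivAt_right (hc.intervalIntegrable _ _)
    hc.aestronglyMeasurable.stronglyMeasurableAtFilter hc.continuousAt).const_add _

end IsH1

/-! ### Cauchy integrals in the upper half plane -/

lemma sub_ofReal_ne_zero {z : ℂ} (hz : 0 < z.im) (y : ℝ) : z - y ≠ 0 := by
  intro h
  have := congrArg Complex.im h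
  simp at this
  exact hz.ne' this

lemma add_ofReal_ne_zero {z : ℂ} (hz : 0 < z.im) (y : ℝ) : z + y ≠ 0 := by
  simpa using sub_ofReal_ne_zero hz (-y)

lemma continuous_inv_sub {z : ℂ} (hz : 0 < z.im) : Continuous fun y : ℝ => (z - y)⁻¹ :=
  Continuous.inv₀ (by fun_prop) (sub_ofReal_ne_zero hz)

lemma norm_inv_sub_sq {z : ℂ} (hz : 0 < z.im) (y : ℝ) :
    ‖(z - y)⁻¹‖ ^ 2 = (z.im ^ 2)⁻¹ * (1 + ((z.re - y) / z.im) ^ 2)⁻¹ := by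
  rw [norm_inv, inv_pow, ← Complex.normSq_eq_norm_sq, Complex.normSq_apply, ← mul_inv]
  congr 1
  simp
  field_simp
  ring

lemma integrable_norm_inv_sub_sq {z : ℂ} (hz : 0 < z.im) :
    Integrable fun y : ℝ => ‖(z - y)⁻¹‖ ^ 2 := by
  simp_rw [norm_inv_sub_sq hz]
  exact ((integrable_inv_one_add_sq.comp_div hz.ne').comp_sub_left z.re).const_mul _

lemma integral_norm_inv_sub_sq {z : ℂ} (hz : 0 < z.im) :
    ∫ y : ℝ, ‖(z - y)⁻¹‖ ^ 2 = Real.pi / z.im := by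
  simp_rw [norm_inv_sub_sq hz]
  rw [integral_const_mul,
    integral_sub_left_eq_self (fun y => (1 + (y / z.im) ^ 2)⁻¹) volume z.re,
    Measure.integral_comp_div (fun y => (1 + y ^ 2)⁻¹), integral_univ_inv_one_add_sq,
    abs_of_pos hz, smul_eq_mul]
  field_simp

lemma memLp_inv_sub {z : ℂ} (hz : 0 < z.im) : MemLp (fun y : ℝ => (z - y)⁻¹) 2 volume :=
  (memLp_two_iff_integrable_sq_norm (continuous_inv_sub hz).aestronglyMeasurable).2
    (integrable_norm_inv_sub_sq hz)

lemma integrable_inv_sub_sq {z : ℂ} (hz : 0 < z.im) :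
    Integrable fun y : ℝ => (z - y)⁻¹ ^ 2 := by
  refine (integrable_norm_inv_sub_sq hz).mono' ((continuous_inv_sub hz).pow 2).aestronglyMeasurable
    (ae_of_all _ fun y => by rw [norm_pow])

/-- The Cauchy integral `∫ f(y) / (z - y) dy`. -/
noncomputable def cauchyOne (f : ℝ → ℝ) (z : ℂ) : ℂ := ∫ y : ℝ, (f y : ℂ) * (z - y)⁻¹

/-- The Cauchy integral `∫ f(y) / (z - y)² dy`, minus the derivative of `cauchyOne f` at `z`. -/
noncomputable def cauchyTwo (f : ℝ → ℝ) (z : ℂ) : ℂ := ∫ y : ℝ, (f y : ℂ) * (z - y)⁻¹ ^ 2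

lemma integrable_mul_inv_sub {f : ℝ → ℝ} (hf : MemLp f 2 volume) {z : ℂ} (hz : 0 < z.im) :
    Integrable fun y : ℝ => (f y : ℂ) * (z - y)⁻¹ :=
  MemLp.integrable_mul hf.ofReal (memLp_inv_sub hz)

lemma IsH1.integrable_mul_inv_sub_sq {f f' : ℝ → ℝ} (h : IsH1 f f') {z : ℂ} (hz : 0 < z.im) :
    Integrable fun y : ℝ => (f y : ℂ) * (z - y)⁻¹ ^ 2 := by
  refine (integrable_inv_sub_sq hz).bdd_mul (c := nrm f + nrm f') ?_ (ae_of_all _ fun y => ?_)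
  · exact (Complex.continuous_ofReal.comp h.cont).aestronglyMeasurable
  · simpa using h.abs_le y

lemma cauchyOne_eq_neg_cauchyTwo {F f f' : ℝ → ℝ} (hF : IsH1 F f) (h : IsH1 f f') {z : ℂ}
    (hz : 0 < z.im) : cauchyOne f z = -cauchyTwo F z := by
  have d1 : ∀ y : ℝ, HasDerivAt (fun y => (F y : ℂ)) (f y : ℂ) y := fun y =>
    (hF.hasDerivAt h.cont y).ofReal_comp
  have d2 : ∀ y : ℝ, HasDerivAt (fun y : ℝ => (z - y)⁻¹) ((z - y)⁻¹ ^ 2) y := fun y => by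
    have := ((Complex.ofRealCLM.hasDerivAt (x := y)).const_sub z).inv (sub_ofReal_ne_zero hz y)
    refine this.congr_deriv ?_
    simp
  have := integral_mul_deriv_eq_deriv_mul_of_integrable (fun y _ => d1 y) (fun y _ => d2 y)
    (hF.integrable_mul_inv_sub_sq hz) (integrable_mul_inv_sub hF.memLp' hz)
    (integrable_mul_inv_sub hF.memLp hz)
  rw [cauchyOne, cauchyTwo, this, neg_neg]

lemma integral_eq_integral_Ioi_add {E : Type*} [NormedAddCommGroup E] [NormedSpace ℝ E]
    {g : ℝ → E} (hg : Integrable g) :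
    ∫ s, g s = ∫ s in Ioi 0, (g s + g (-s)) := by
  rw [integral_add hg.integrableOn hg.comp_neg.integrableOn, integral_comp_neg_Ioi, neg_zero,
    add_comm, intervalIntegral.integral_Iic_add_Ioi hg.integrableOn hg.integrableOn]

/-! ### Boundary values of Cauchy integrals -/

section Boundary

variable {f f' : ℝ → ℝ}

/-- Real and imaginary part of the Cauchy integral at height `ε`, folded like the Hilbert transform;
the Poisson integral is rescaled so that its limit `ε → 0` is one of dominated convergence. -/
lemma cauchyOne_eq (h : IsH1 f f') (x : ℝ) {ε : ℝ} (hε : 0 < ε) :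
    cauchyOne f (x + ε * Complex.I) =
      ((∫ s in Ioi 0, (f (x - s) - f (x + s)) / s * (s ^ 2 / (s ^ 2 + ε ^ 2)) : ℝ) : ℂ) -
      Complex.I * ((∫ u in Ioi 0, (f (x - ε * u) + f (x + ε * u)) * (1 + u ^ 2)⁻¹ : ℝ) : ℂ) := by
  have hz : 0 < (x + ε * Complex.I : ℂ).im := by simpa
  have cf := h.cont
  have hi := integrable_mul_inv_sub h.memLp hz
  have hi' : Integrable (fun s : ℝ => ((f (x - s) : ℝ) : ℂ) * (s + ε * Complex.I)⁻¹) := by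
    refine (hi.comp_sub_left x).congr (ae_of_all _ fun s => ?_)
    simp only; push_cast; congr 2; ring
  have i1 : IntegrableOn (fun s => (f (x - s) - f (x + s)) / s * (s ^ 2 / (s ^ 2 + ε ^ 2)))
      (Ioi 0) := by
    refine (h.integrableOn_diff_div x).mul_bdd (c := 1)
      (Measurable.aestronglyMeasurable (by fun_prop)) (ae_of_all _ fun s => ?_)
    rw [Real.norm_of_nonneg (by positivity)]
    exact div_le_one_of_le₀ (by nlinarith [sq_nonneg ε]) (by positivity)
  have i2 : IntegrableOn (fun s => ε * (f (x - s) + f (x + s)) / (s ^ 2 + ε ^ 2)) (Ioi 0) := by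
    have := (integrable_norm_inv_sub_sq (z := ε * Complex.I) (by simpa)).integrableOn (s := Ioi 0)
    refine (this.bdd_mul (f := fun s => ε * (f (x - s) + f (x + s)))
      (c := ε * (2 * (nrm f + nrm f')))
      (Continuous.aestronglyMeasurable (by fun_prop)) (ae_of_all _ fun s => ?_)).congr
      (ae_of_all _ fun s => ?_)
    · rw [norm_mul, Real.norm_of_nonneg hε.le]
      exact mul_le_mul_of_nonneg_left ((norm_add_le _ _).trans (by
        simp only [Real.norm_eq_abs]
        linarith [h.abs_le (x - s), h.abs_le (x + s)])) hε.le
    · simp only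
      rw [norm_inv, inv_pow, ← Complex.normSq_eq_norm_sq, Complex.normSq_apply, div_eq_mul_inv]
      simp [sq]
  have e2 : ∫ u in Ioi 0, (f (x - ε * u) + f (x + ε * u)) * (1 + u ^ 2)⁻¹ =
      ∫ s in Ioi 0, ε * (f (x - s) + f (x + s)) / (s ^ 2 + ε ^ 2) := by
    have := integral_comp_mul_left_Ioi
      (fun s => ε * (ε * (f (x - s) + f (x + s)) / (s ^ 2 + ε ^ 2))) 0 hε
    rw [mul_zero, integral_const_mul ε (fun s => ε * (f (x - s) + f (x + s)) / (s ^ 2 + ε ^ 2)),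
      smul_eq_mul, inv_mul_cancel_left₀ hε.ne'] at this
    rw [← this]
    refine setIntegral_congr_fun measurableSet_Ioi fun u _ => ?_
    field_simp
    ring
  have e0 : cauchyOne f (x + ε * Complex.I) =
      ∫ s : ℝ, ((f (x - s) : ℝ) : ℂ) * (s + ε * Complex.I)⁻¹ := by
    rw [cauchyOne, ← integral_sub_left_eq_self _ volume x]
    refine integral_congr_ae (ae_of_all _ fun s => ?_)
    simp only; push_cast; congr 2; ring
  rw [e0, e2, integral_eq_integral_Ioi_add hi', ← integral_complex_ofReal,
    ← integral_complex_ofReal, ← integral_const_mul, ← integral_sub i1.ofReal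
      (i2.ofReal.const_mul _)]
  refine setIntegral_congr_fun measurableSet_Ioi fun s hs => ?_
  have hs0 : (s : ℂ) ≠ 0 := by exact_mod_cast (ne_of_gt hs)
  have n0 : (s ^ 2 + ε ^ 2 : ℂ) ≠ 0 := by
    have : s ^ 2 + ε ^ 2 ≠ 0 := by positivity
    exact_mod_cast this
  have n1 : (s + ε * Complex.I : ℂ) ≠ 0 := fun h0 => hε.ne' (by simpa using congrArg Complex.im h0)
  have n2 : (-s + ε * Complex.I : ℂ) ≠ 0 := fun h0 => hε.ne' (by simpa using congrArg Complex.im h0)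
  have k1 : (s + ε * Complex.I : ℂ)⁻¹ = (s - ε * Complex.I) / (s ^ 2 + ε ^ 2) := by
    rw [inv_eq_iff_eq_inv, inv_div, eq_div_iff]
    · linear_combination (ε : ℂ) ^ 2 * (-Complex.I_sq)
    · intro h0; exact hε.ne' (by simpa using congrArg Complex.im h0)
  have k2 : (-s + ε * Complex.I : ℂ)⁻¹ = (-s - ε * Complex.I) / (s ^ 2 + ε ^ 2) := by
    rw [inv_eq_iff_eq_inv, inv_div, eq_div_iff]
    · linear_combination (ε : ℂ) ^ 2 * (-Complex.I_sq)
    · intro h0; exact hε.ne' (by simpa using congrArg Complex.im h0)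
  simp only [sub_neg_eq_add]
  push_cast
  rw [k1, k2]
  field_simp
  ring

/-- On the boundary of the upper half plane the Cauchy integral of `f` is `π (ℋ f - i f)`. -/
lemma tendsto_cauchyOne (h : IsH1 f f') (x : ℝ) :
    Tendsto (fun ε : ℝ => cauchyOne f (x + ε * Complex.I)) (𝓝[>] 0)
      (𝓝 (foldedHilbert f x - Complex.I * (Real.pi * f x : ℝ))) := by
  have cf := h.cont
  have t1 : Tendsto (fun ε : ℝ =>
      ∫ s in Ioi 0, (f (x - s) - f (x + s)) / s * (s ^ 2 / (s ^ 2 + ε ^ 2))) (𝓝[>] 0)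
      (𝓝 (foldedHilbert f x)) := by
    refine tendsto_integral_filter_of_dominated_convergence
      (fun s => |(f (x - s) - f (x + s)) / s|) ?_ ?_ (h.integrableOn_diff_div x).abs ?_
    · exact Eventually.of_forall fun ε => Measurable.aestronglyMeasurable (by fun_prop)
    · refine Eventually.of_forall fun ε => ae_of_all _ fun s => ?_
      rw [norm_mul, Real.norm_eq_abs]
      refine mul_le_of_le_one_right (abs_nonneg _) ?_
      rw [Real.norm_of_nonneg (by positivity)]
      exact div_le_one_of_le₀ (by nlinarith [sq_nonneg ε]) (by positivity)
    · filter_upwards [ae_restrict_mem measurableSet_Ioi] with s hs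
      have hs0 : s ≠ 0 := ne_of_gt hs
      have : ContinuousAt (fun ε : ℝ => (f (x - s) - f (x + s)) / s * (s ^ 2 / (s ^ 2 + ε ^ 2)))
          0 := by
        refine ContinuousAt.mul continuousAt_const (ContinuousAt.div (by fun_prop) (by fun_prop) ?_)
        positivity
      have := this.tendsto.mono_left (nhdsWithin_le_nhds (s := Ioi 0))
      simpa [hs0] using this
  have t2 : Tendsto (fun ε : ℝ =>
      ∫ u in Ioi 0, (f (x - ε * u) + f (x + ε * u)) * (1 + u ^ 2)⁻¹) (𝓝[>] 0)
      (𝓝 (Real.pi * f x)) := by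
    have e : Real.pi * f x = ∫ u in Ioi (0 : ℝ), (f x + f x) * (1 + u ^ 2)⁻¹ := by
      rw [integral_const_mul, integral_Ioi_inv_one_add_sq, Real.arctan_zero]; ring
    rw [e]
    refine tendsto_integral_filter_of_dominated_convergence
      (fun u => (2 * (nrm f + nrm f')) * (1 + u ^ 2)⁻¹) ?_ ?_
      (integrable_inv_one_add_sq.const_mul _).integrableOn ?_
    · exact Eventually.of_forall fun ε => Measurable.aestronglyMeasurable (by fun_prop)
    · refine Eventually.of_forall fun ε => ae_of_all _ fun s => ?_
      rw [norm_mul, Real.norm_of_nonneg (show 0 ≤ (1 + s ^ 2)⁻¹ by positivity)]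
      refine mul_le_mul_of_nonneg_right ((norm_add_le _ _).trans (by
        simp only [Real.norm_eq_abs]
        linarith [h.abs_le (x - ε * s), h.abs_le (x + ε * s)])) (by positivity)
    · refine ae_of_all _ fun u => ?_
      have : Continuous (fun ε : ℝ => (f (x - ε * u) + f (x + ε * u)) * (1 + u ^ 2)⁻¹) := by
        fun_prop
      simpa using (this.tendsto 0).mono_left (nhdsWithin_le_nhds (s := Ioi 0))
  have t := ((Complex.continuous_ofReal.tendsto _).comp t1).sub
    (((Complex.continuous_ofReal.tendsto _).comp t2).const_mul Complex.I)
  refine t.congr' ?_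
  filter_upwards [self_mem_nhdsWithin] with ε hε
  rw [cauchyOne_eq h x hε]
  rfl

lemma norm_cauchyOne_le (h : IsH1 f f') {z : ℂ} (hz : 0 < z.im) :
    ‖cauchyOne f z‖ ≤ 7 * (nrm f + nrm f') := by
  rw [← Complex.re_add_im z, cauchyOne_eq h z.re hz]
  have hn := nrm_nonneg f
  have hn' := nrm_nonneg f'
  refine (norm_sub_le _ _).trans ?_
  rw [norm_mul, Complex.norm_I, one_mul, Complex.norm_real, Complex.norm_real]
  have b1 : ‖∫ s in Ioi 0, (f (z.re - s) - f (z.re + s)) / s * (s ^ 2 / (s ^ 2 + z.im ^ 2))‖ ≤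
      2 * nrm f + 3 * nrm f' := by
    refine (norm_integral_le_of_norm_le (h.integrableOn_diff_div z.re).abs
      (ae_of_all _ fun s => ?_)).trans (h.integral_abs_diff_div_le z.re)
    rw [norm_mul, Real.norm_eq_abs]
    refine mul_le_of_le_one_right (abs_nonneg _) ?_
    rw [Real.norm_of_nonneg (by positivity)]
    exact div_le_one_of_le₀ (by nlinarith [sq_nonneg z.im]) (by positivity)
  have b2 : ‖∫ u in Ioi 0, (f (z.re - z.im * u) + f (z.re + z.im * u)) * (1 + u ^ 2)⁻¹‖ ≤
      Real.pi * (nrm f + nrm f') := by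
    have : ∫ u in Ioi (0 : ℝ), (2 * (nrm f + nrm f')) * (1 + u ^ 2)⁻¹ =
        Real.pi * (nrm f + nrm f') := by
      rw [integral_const_mul, integral_Ioi_inv_one_add_sq, Real.arctan_zero]; ring
    rw [← this]
    refine norm_integral_le_of_norm_le (integrable_inv_one_add_sq.const_mul _).integrableOn
      (ae_of_all _ fun s => ?_)
    rw [norm_mul, Real.norm_of_nonneg (show 0 ≤ (1 + s ^ 2)⁻¹ by positivity)]
    refine mul_le_mul_of_nonneg_right ((norm_add_le _ _).trans (by
      simp only [Real.norm_eq_abs]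
      linarith [h.abs_le (z.re - z.im * s), h.abs_le (z.re + z.im * s)])) (by positivity)
  have := mul_le_mul_of_nonneg_right Real.pi_lt_four.le (add_nonneg hn hn')
  linarith

end Boundary

/-! ### Cauchy integrals of products with the Hilbert transform -/

lemma integrable_mul_of_integral_norm_le {ν : Measure ℝ} [SFinite ν] {G : ℝ → ℂ}
    (hG : Integrable G) {K : ℝ → ℝ → ℂ} (hK : Measurable (Function.uncurry K))
    (hi : ∀ y, Integrable (K y) ν) {C : ℝ} (hC : ∀ y, ∫ s, ‖K y s‖ ∂ν ≤ C) :
    Integrable (Function.uncurry fun y s => G y * K y s) (volume.prod ν) := by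
  have hm : AEStronglyMeasurable (Function.uncurry fun y s => G y * K y s) (volume.prod ν) :=
    hG.1.comp_fst.mul hK.aestronglyMeasurable
  rw [integrable_prod_iff hm]
  refine ⟨ae_of_all _ fun y => (hi y).const_mul (G y), ?_⟩
  have h1 : (fun y => ∫ s, ‖Function.uncurry (fun y s => G y * K y s) (y, s)‖ ∂ν) =
      fun y => ‖G y‖ * ∫ s, ‖K y s‖ ∂ν := by
    ext y
    simp [integral_const_mul]
  rw [h1]
  refine hG.norm.mul_bdd (c := C)
    hK.norm.stronglyMeasurable.integral_prod_right.aestronglyMeasurable (ae_of_all _ fun y => ?_)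
  rw [Real.norm_of_nonneg (integral_nonneg fun _ => norm_nonneg _)]
  exact hC y

section

variable {f f' : ℝ → ℝ}

/-- The duality behind both product formulas: the Hilbert transform of `f` is tested against an
integrable `G` by exchanging the order of integration. -/
lemma integral_mul_foldedHilbert (h : IsH1 f f') {G : ℝ → ℂ} (hG : Integrable G) :
    ∫ y, G y * foldedHilbert f y =
      ∫ s in Ioi (0 : ℝ), ∫ y, (G y * (f (y - s) : ℂ) - G (y - s) * (f y : ℂ)) / s := by
  have cf := h.cont
  have hK : Measurable (Function.uncurry fun y s : ℝ =>
      (((f (y - s) - f (y + s)) / s : ℝ) : ℂ)) := by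
    unfold Function.uncurry; fun_prop
  have hint := integrable_mul_of_integral_norm_le (ν := volume.restrict (Ioi 0)) hG hK
    (fun y => (h.integrableOn_diff_div y).ofReal) (C := 2 * nrm f + 3 * nrm f') (fun y => by
      simpa only [Complex.norm_real, Real.norm_eq_abs] using h.integral_abs_diff_div_le y)
  have e1 : ∫ y, G y * foldedHilbert f y =
      ∫ y, ∫ s in Ioi (0 : ℝ), G y * (((f (y - s) - f (y + s)) / s : ℝ) : ℂ) := by
    congr 1; ext y
    rw [integral_const_mul, foldedHilbert, integral_complex_ofReal]
  rw [e1, integral_integral_swap hint]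
  refine setIntegral_congr_fun measurableSet_Ioi fun s hs => ?_
  have b : ∀ a : ℝ, Integrable fun y => G y * (f (y + a) : ℂ) := fun a => by
    refine hG.mul_bdd (c := nrm f + nrm f') (Continuous.aestronglyMeasurable (by fun_prop))
      (ae_of_all _ fun y => ?_)
    simpa using h.abs_le (y + a)
  have b1 : Integrable fun y => G y * (f (y - s) : ℂ) := b (-s)
  have b2 : Integrable fun y => G (y - s) * (f y : ℂ) := by
    simpa using (b s).comp_sub_right s
  have e2 : ∫ y, G y * (f (y + s) : ℂ) = ∫ y, G (y - s) * (f y : ℂ) := by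
    rw [← integral_sub_right_eq_self _ s]
    simp
  rw [integral_div, integral_sub b1 b2, ← e2, ← integral_sub b1 (b s), ← integral_div]
  congr 1; ext y
  push_cast
  ring

lemma integral_Ioi_sub_add_add {E : Type*} [NormedAddCommGroup E] [NormedSpace ℝ E]
    {g : ℝ → E} (hg : Integrable g) (y : ℝ) :
    ∫ s in Ioi 0, (g (y - s) + g (y + s)) = ∫ x, g x := by
  rw [← integral_sub_left_eq_self g volume y, integral_eq_integral_Ioi_add (hg.comp_sub_left y)]
  simp

/-- Paired with `(z - y)⁻¹ ^ 2`, the product `f · ℋ f` gives a product of Cauchy integrals of `f`.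
This is the identity `ℋ (f ℋ f) = ((ℋ f) ^ 2 - f ^ 2) / 2` differentiated and extended to the half
plane. It holds because the kernel `k y = (z - y)⁻¹ ^ 2` satisfies
`(k y - k y') / (y - y') = (z - y)⁻¹ ^ 2 * (z - y')⁻¹ + (z - y)⁻¹ * (z - y')⁻¹ ^ 2`. -/
lemma integral_mul_foldedHilbert_mul_inv_sub_sq (h : IsH1 f f') {z : ℂ} (hz : 0 < z.im) :
    ∫ y : ℝ, ((f y : ℂ) * (z - y)⁻¹ ^ 2) * foldedHilbert f y = cauchyOne f z * cauchyTwo f z := by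
  have cf := h.cont
  have ck := continuous_inv_sub hz
  set φ₁ : ℝ → ℂ := fun y => (f y : ℂ) * (z - y)⁻¹ with hφ₁
  set φ₂ : ℝ → ℂ := fun y => (f y : ℂ) * (z - y)⁻¹ ^ 2 with hφ₂
  have i1 : Integrable φ₁ := integrable_mul_inv_sub h.memLp hz
  have i2 : Integrable φ₂ := h.integrable_mul_inv_sub_sq hz
  have c1 : Continuous φ₁ := (Complex.continuous_ofReal.comp cf).mul ck
  obtain ⟨M, hM⟩ : ∃ M, ∀ y, ‖φ₁ y‖ ≤ M := by
    refine ⟨(nrm f + nrm f') * z.im⁻¹, fun y => ?_⟩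
    rw [hφ₁, norm_mul, norm_inv]
    refine mul_le_mul (by simpa using h.abs_le y) ?_ (by positivity)
      (add_nonneg (nrm_nonneg _) (nrm_nonneg _))
    refine inv_anti₀ hz ?_
    simpa [abs_of_pos hz] using Complex.abs_im_le_norm (z - y)
  have b : ∀ a : ℝ, Integrable fun y => φ₂ y * φ₁ (y + a) := fun a =>
    i2.mul_bdd (c := M) (Continuous.aestronglyMeasurable (by fun_prop)) (ae_of_all _ fun y => hM _)
  have hint : Integrable (Function.uncurry fun y s => φ₂ y * (φ₁ (y - s) + φ₁ (y + s)))
      (volume.prod (volume.restrict (Ioi 0))) := by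
    refine integrable_mul_of_integral_norm_le i2 (K := fun y s => φ₁ (y - s) + φ₁ (y + s))
      (C := ∫ x, ‖φ₁ x‖) ?_ (fun y => ?_) (fun y => ?_)
    · unfold Function.uncurry; fun_prop
    · exact ((i1.comp_sub_left y).add (i1.comp_add_left y)).integrableOn
    · rw [← integral_Ioi_sub_add_add i1.norm y]
      exact setIntegral_mono ((i1.comp_sub_left y).add (i1.comp_add_left y)).norm.integrableOn
        ((i1.norm.comp_sub_left y).add (i1.norm.comp_add_left y)).integrableOn
        fun s => norm_add_le _ _
  rw [integral_mul_foldedHilbert h i2]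
  calc _ = ∫ s in Ioi (0 : ℝ), ∫ y, φ₂ y * (φ₁ (y - s) + φ₁ (y + s)) := by
        refine setIntegral_congr_fun measurableSet_Ioi fun s hs => ?_
        have hs0 : (s : ℂ) ≠ 0 := by exact_mod_cast (ne_of_gt hs)
        have e : ∀ y : ℝ, (φ₂ y * (f (y - s) : ℂ) - φ₂ (y - s) * (f y : ℂ)) / s =
            φ₂ y * φ₁ (y - s) + φ₂ (y - s) * φ₁ y := by
          intro y
          have n1 := sub_ofReal_ne_zero hz y
          have n2 := sub_ofReal_ne_zero hz (y - s)
          simp only [hφ₁, hφ₂]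
          push_cast at n2 ⊢
          field_simp
          ring
        have b2 : Integrable fun y => φ₂ (y - s) * φ₁ y := by
          simpa using (b s).comp_sub_right s
        have e2 : ∫ y, φ₂ y * φ₁ (y + s) = ∫ y, φ₂ (y - s) * φ₁ y := by
          rw [← integral_sub_right_eq_self _ s]
          simp
        have b1 : Integrable fun y => φ₂ y * φ₁ (y - s) := b (-s)
        simp only [e, mul_add]
        rw [integral_add b1 b2, integral_add b1 (b s), e2]
    _ = ∫ y, ∫ s in Ioi (0 : ℝ), φ₂ y * (φ₁ (y - s) + φ₁ (y + s)) :=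
        (integral_integral_swap hint).symm
    _ = ∫ y, φ₂ y * ∫ x, φ₁ x := by
        congr 1; ext y
        rw [integral_const_mul, integral_Ioi_sub_add_add i1]
    _ = _ := by
        rw [integral_mul_const, mul_comm]
        rfl

/-- The primitive with which `integral_kernel` is evaluated. The factor `I` keeps the argument of
the logarithm off the branch cut for all `s ≥ 0`. -/
lemma hasDerivAt_primitive {q : ℂ} (hq : 0 < q.im) {s : ℝ} (hs : 0 ≤ s) :
    HasDerivAt (fun s : ℝ => -Complex.log (Complex.I * ((s - q) / (s + q))) / q ^ 2 -
      2 / q * (s / (s ^ 2 - q ^ 2))) (4 * q / (q ^ 2 - s ^ 2) ^ 2) s := by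
  have hq0 : q ≠ 0 := by rintro rfl; simp at hq
  have n1 : (s : ℂ) + q ≠ 0 := by rw [add_comm]; exact add_ofReal_ne_zero hq s
  have n2 : q - (s : ℂ) ≠ 0 := sub_ofReal_ne_zero hq s
  have n2' : (s : ℂ) - q ≠ 0 := by rw [← neg_sub]; exact neg_ne_zero.2 n2
  have n3 : (s : ℂ) ^ 2 - q ^ 2 ≠ 0 := by rw [sq_sub_sq]; exact mul_ne_zero n1 n2'
  have n4 : q ^ 2 - (s : ℂ) ^ 2 ≠ 0 := by rw [← neg_sub]; exact neg_ne_zero.2 n3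
  have hsl : Complex.I * ((s - q) / (s + q)) ∈ Complex.slitPlane := by
    rcases hs.eq_or_lt with rfl | hs
    · right
      simp [hq0]
    · left
      rw [Complex.I_mul_re, Complex.div_im]
      have : 0 < Complex.normSq (s + q) := Complex.normSq_pos.2 n1
      rw [← sub_div, neg_div']
      refine div_pos ?_ this
      simp
      nlinarith [mul_pos hs hq]
  have d0 : HasDerivAt (fun s : ℝ => (s : ℂ)) 1 s := Complex.ofRealCLM.hasDerivAt
  have d1 := ((d0.sub_const q).div (d0.add_const q) n1).const_mul Complex.I
  have d2 := d1.clog_real hsl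
  have d3 := (d2.neg.div_const (q ^ 2)).sub
    ((d0.div ((d0.pow 2).sub_const (q ^ 2)) n3).const_mul (2 / q))
  refine d3.congr_deriv ?_
  simp
  field_simp
  ring

/-- By the parallelogram law `‖q‖ ^ 2 ≤ ‖q + s‖ ^ 2 + ‖q - s‖ ^ 2`; the integral of
the bound in `s` does not depend on `q.re`. -/
lemma norm_inv_sub_sq_mul_le {q : ℂ} (hq : 0 < q.im) (s : ℝ) :
    ‖4 * q ^ 2 / (q ^ 2 - s ^ 2) ^ 2‖ ≤ 4 * (‖(q + s)⁻¹‖ ^ 2 + ‖(q - s)⁻¹‖ ^ 2) := by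
  have n1 := norm_pos_iff.2 (add_ofReal_ne_zero hq s)
  have n2 := norm_pos_iff.2 (sub_ofReal_ne_zero hq s)
  have e : q ^ 2 - (s : ℂ) ^ 2 = (q + s) * (q - s) := by ring
  have h : ‖q‖ ^ 2 ≤ ‖q + s‖ ^ 2 + ‖q - s‖ ^ 2 := by
    simp only [← Complex.normSq_eq_norm_sq, Complex.normSq_apply]
    simp
    nlinarith [sq_nonneg q.re, sq_nonneg q.im, sq_nonneg s]
  rw [e, norm_div, norm_mul, norm_pow, norm_pow, norm_mul, norm_inv, norm_inv, inv_pow, inv_pow,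
    inv_add_inv (by positivity) (by positivity), mul_div_assoc, mul_pow, Complex.norm_ofNat]
  gcongr

lemma integrableOn_kernel {q : ℂ} (hq : 0 < q.im) :
    IntegrableOn (fun s : ℝ => 4 * q ^ 2 / (q ^ 2 - (s : ℂ) ^ 2) ^ 2) (Ioi 0) ∧
    ∫ s in Ioi (0 : ℝ), ‖4 * q ^ 2 / (q ^ 2 - (s : ℂ) ^ 2) ^ 2‖ ≤ 4 * (Real.pi / q.im) := by
  have i := integrable_norm_inv_sub_sq hq
  have i1 : Integrable fun s : ℝ => 4 * (‖(q + s)⁻¹‖ ^ 2 + ‖(q - s)⁻¹‖ ^ 2) := by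
    have := i.comp_neg
    simp only [Complex.ofReal_neg, sub_neg_eq_add] at this
    exact (this.add i).const_mul 4
  have i2 : IntegrableOn (fun s : ℝ => 4 * q ^ 2 / (q ^ 2 - (s : ℂ) ^ 2) ^ 2) (Ioi 0) :=
    i1.integrableOn.mono' (Measurable.aestronglyMeasurable (by fun_prop))
      (ae_of_all _ fun s => norm_inv_sub_sq_mul_le hq s)
  refine ⟨i2, (setIntegral_mono i2.norm i1.integrableOn
    fun s => norm_inv_sub_sq_mul_le hq s).trans (le_of_eq ?_)⟩
  rw [integral_const_mul, ← integral_norm_inv_sub_sq hq, ← integral_Ioi_sub_add_add i 0]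
  simp

/-- The kernel `(z - y)⁻¹ ^ 2` is an eigenfunction of the Hilbert transform: with `q = z - y`, the
integrand is `q` times the folded difference `((z - (y + s))⁻¹ ^ 2 - (z - (y - s))⁻¹ ^ 2) / s`. -/
lemma integral_kernel {q : ℂ} (hq : 0 < q.im) :
    ∫ s in Ioi (0 : ℝ), 4 * q ^ 2 / (q ^ 2 - (s : ℂ) ^ 2) ^ 2 = -(Complex.I * Real.pi * q⁻¹) := by
  have hq0 : q ≠ 0 := by rintro rfl; simp at hq
  have hlim : Tendsto (fun s : ℝ => -Complex.log (Complex.I * ((s - q) / (s + q))) / q ^ 2 -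
      2 / q * (s / (s ^ 2 - q ^ 2))) atTop (𝓝 (-Complex.log Complex.I / q ^ 2)) := by
    have hinv : Tendsto (fun s : ℝ => (s : ℂ)⁻¹) atTop (𝓝 0) :=
      tendsto_inv₀_cobounded.comp (RCLike.tendsto_ofReal_atTop_cobounded ℂ)
    have t1 : Tendsto (fun s : ℝ => ((s : ℂ) - q) / (s + q)) atTop (𝓝 1) := by
      have : Tendsto (fun s : ℝ => (1 - q * (s : ℂ)⁻¹) / (1 + q * (s : ℂ)⁻¹)) atTop
          (𝓝 ((1 - q * 0) / (1 + q * 0))) :=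
        ((hinv.const_mul q).const_sub 1).div ((hinv.const_mul q).const_add 1) (by simp)
      simp only [mul_zero, sub_zero, add_zero, div_one] at this
      refine this.congr' ?_
      filter_upwards [eventually_gt_atTop 0] with s hs
      have hs0 : (s : ℂ) ≠ 0 := by exact_mod_cast hs.ne'
      have := add_ofReal_ne_zero hq s
      rw [add_comm] at this
      field_simp
    have t2 : Tendsto (fun s : ℝ => (s : ℂ) / (s ^ 2 - q ^ 2)) atTop (𝓝 0) := by
      have : Tendsto (fun s : ℝ => (s : ℂ)⁻¹ / (1 - (q * (s : ℂ)⁻¹) ^ 2)) atTop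
          (𝓝 (0 / (1 - (q * 0) ^ 2))) :=
        hinv.div (((hinv.const_mul q).pow 2).const_sub 1) (by simp)
      simp only [mul_zero, zero_div] at this
      refine this.congr' ?_
      filter_upwards [eventually_gt_atTop 0] with s hs
      have hs0 : (s : ℂ) ≠ 0 := by exact_mod_cast hs.ne'
      field_simp
    have t3 := (t1.const_mul Complex.I).clog (Or.inr (by simp))
    have := (t3.neg.div_const (q ^ 2)).sub (t2.const_mul (2 / q))
    simpa using this
  have hi : IntegrableOn (fun s : ℝ => 4 * q / (q ^ 2 - (s : ℂ) ^ 2) ^ 2) (Ioi 0) := by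
    refine ((integrableOn_kernel hq).1.const_mul q⁻¹).congr (ae_of_all _ fun s => ?_)
    simp only
    field_simp
  have := integral_Ioi_of_hasDerivAt_of_tendsto
    (hasDerivAt_primitive hq le_rfl).continuousAt.continuousWithinAt
    (fun s hs => hasDerivAt_primitive hq (le_of_lt hs)) hi hlim
  have e : ∫ s in Ioi (0 : ℝ), 4 * q ^ 2 / (q ^ 2 - (s : ℂ) ^ 2) ^ 2 =
      q * ∫ s in Ioi (0 : ℝ), 4 * q / (q ^ 2 - (s : ℂ) ^ 2) ^ 2 := by
    rw [← integral_const_mul]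
    congr 1; ext s; ring
  rw [e, this]
  have e2 : Complex.I * (((0 : ℝ) - q) / ((0 : ℝ) + q)) = -Complex.I := by
    simp [hq0]
  rw [e2, Complex.log_neg_I, Complex.log_I]
  simp
  field_simp
  ring

/-- Paired with `(z - y)⁻¹ ^ 2`, the function `ℋ f` gives `-i` times what `f` gives. -/
lemma integral_inv_sub_sq_mul_foldedHilbert (h : IsH1 f f') {z : ℂ} (hz : 0 < z.im) :
    ∫ y : ℝ, (z - y)⁻¹ ^ 2 * (foldedHilbert f y : ℂ) =
      -(Complex.I * Real.pi) * cauchyTwo f z := by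
  have cf := h.cont
  have hq : ∀ y : ℝ, 0 < (z - y).im := fun y => by simpa
  have hint : Integrable (Function.uncurry fun y s : ℝ => ((f y : ℂ) * (z - y)⁻¹) *
      (4 * (z - y) ^ 2 / ((z - y) ^ 2 - (s : ℂ) ^ 2) ^ 2))
      (volume.prod (volume.restrict (Ioi 0))) := by
    refine integrable_mul_of_integral_norm_le (integrable_mul_inv_sub h.memLp hz)
      (K := fun y s : ℝ => 4 * (z - y) ^ 2 / ((z - y) ^ 2 - (s : ℂ) ^ 2) ^ 2)
      (C := 4 * (Real.pi / z.im)) ?_ (fun y => (integrableOn_kernel (hq y)).1) (fun y => ?_)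
    · unfold Function.uncurry; fun_prop
    · simpa only [Complex.sub_im, Complex.ofReal_im, sub_zero] using (integrableOn_kernel (hq y)).2
  rw [integral_mul_foldedHilbert h (integrable_inv_sub_sq hz)]
  calc _ = ∫ s in Ioi (0 : ℝ), ∫ y : ℝ, ((f y : ℂ) * (z - y)⁻¹) *
        (4 * (z - y) ^ 2 / ((z - y) ^ 2 - (s : ℂ) ^ 2) ^ 2) := by
        refine setIntegral_congr_fun measurableSet_Ioi fun s hs => ?_
        have hs0 : (s : ℂ) ≠ 0 := by exact_mod_cast (ne_of_gt hs)
        have b : ∀ a c : ℝ, Integrable fun y : ℝ => (z - (y + a : ℝ))⁻¹ ^ 2 * (f (y + c) : ℂ) := by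
          intro a c
          refine ((integrable_inv_sub_sq hz).comp_add_right a).mul_bdd (c := nrm f + nrm f')
            (Continuous.aestronglyMeasurable (by fun_prop)) (ae_of_all _ fun y => ?_)
          simpa using h.abs_le (y + c)
        have b1 : Integrable fun y : ℝ => (z - y)⁻¹ ^ 2 * (f (y - s) : ℂ) := by
          simpa [sub_eq_add_neg] using b 0 (-s)
        have b2 : Integrable fun y : ℝ => (z - (y - s : ℝ))⁻¹ ^ 2 * (f y : ℂ) := by
          simpa [sub_eq_add_neg] using b (-s) 0
        have b3 : Integrable fun y : ℝ => (z - (y + s : ℝ))⁻¹ ^ 2 * (f y : ℂ) := by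
          simpa using b s 0
        have e2 : ∫ y : ℝ, (z - y)⁻¹ ^ 2 * (f (y - s) : ℂ) =
            ∫ y : ℝ, (z - (y + s : ℝ))⁻¹ ^ 2 * (f y : ℂ) := by
          rw [← integral_add_right_eq_self _ s]
          simp
        rw [integral_div, integral_sub b1 b2, e2, ← integral_sub b3 b2, ← integral_div]
        congr 1; ext y
        have n0 := sub_ofReal_ne_zero hz y
        have n1 := sub_ofReal_ne_zero hz (y - s)
        have n2 := sub_ofReal_ne_zero hz (y + s)
        push_cast at n1 n2 ⊢
        have e3 : (z - y) ^ 2 - (s : ℂ) ^ 2 = (z - (y - s)) * (z - (y + s)) := by ring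
        rw [e3]
        field_simp
        ring
    _ = ∫ y : ℝ, ∫ s in Ioi (0 : ℝ), ((f y : ℂ) * (z - y)⁻¹) *
        (4 * (z - y) ^ 2 / ((z - y) ^ 2 - (s : ℂ) ^ 2) ^ 2) :=
        (integral_integral_swap hint).symm
    _ = ∫ y : ℝ, -(Complex.I * Real.pi) * ((f y : ℂ) * (z - y)⁻¹ ^ 2) := by
        congr 1; ext y
        rw [integral_const_mul, integral_kernel (hq y)]
        ring
    _ = _ := by
        rw [integral_const_mul]
        rfl

end

/-! ### The operator `π (ℋ - i)` -/

/-- `π (ℋ f - i f)`, the boundary value of the Cauchy integral of `f`. -/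
noncomputable def boundaryValue (f : ℝ → ℝ) (x : ℝ) : ℂ :=
  foldedHilbert f x - Complex.I * (Real.pi * f x : ℝ)

section

variable {f f' g g' : ℝ → ℝ}

lemma boundaryValue_sub (h : IsH1 f f') (hg : IsH1 g g') (x : ℝ) :
    boundaryValue (f - g) x = boundaryValue f x - boundaryValue g x := by
  simp only [boundaryValue, h.foldedHilbert_sub hg, Pi.sub_apply]
  push_cast
  ring

lemma norm_boundaryValue_le (h : IsH1 f f') (x : ℝ) :
    ‖boundaryValue f x‖ ≤ 7 * (nrm f + nrm f') := by
  refine le_of_tendsto (tendsto_cauchyOne h x).norm ?_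
  filter_upwards [self_mem_nhdsWithin] with ε hε
  exact norm_cauchyOne_le h (by simpa using hε)

lemma hasDerivAt_boundaryValue {f'' : ℝ → ℝ} (h : IsH1 f f') (h' : IsH1 f' f'') (x : ℝ) :
    HasDerivAt (boundaryValue f) (boundaryValue f' x) x :=
  (h.hasDerivAt_foldedHilbert h' x).ofReal_comp.sub
    (((h.hasDerivAt h'.cont x).const_mul Real.pi).ofReal_comp.const_mul Complex.I)

lemma continuous_boundaryValue {F : ℝ → ℝ} (hF : IsH1 F f) (h : IsH1 f f') :
    Continuous (boundaryValue f) := by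
  have := hF.continuous_foldedHilbert h
  have := h.cont
  unfold boundaryValue
  fun_prop

lemma cauchyOne_sub (h : IsH1 f f') (hg : IsH1 g g') {z : ℂ} (hz : 0 < z.im) :
    cauchyOne (f - g) z = cauchyOne f z - cauchyOne g z := by
  unfold cauchyOne
  rw [← integral_sub (integrable_mul_inv_sub h.memLp hz) (integrable_mul_inv_sub hg.memLp hz)]
  congr 1; ext y
  simp only [Pi.sub_apply]
  push_cast
  ring

lemma abs_nrm_sub_nrm_le {f g : ℝ → ℝ} (hf : MemLp f 2 volume) (hg : MemLp g 2 volume) :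
    |nrm f - nrm g| ≤ nrm (f - g) := by
  have tri : ∀ {u v : ℝ → ℝ}, MemLp u 2 volume → MemLp v 2 volume →
      nrm u ≤ nrm (u - v) + nrm v := by
    intro u v hu hv
    have := eLpNorm_add_le (p := 2) (hu.sub hv).1 hv.1 (by norm_num)
    rw [sub_add_cancel] at this
    have h2 := ENNReal.toReal_mono (ENNReal.add_ne_top.2 ⟨(hu.sub hv).2.ne, hv.2.ne⟩) this
    rwa [ENNReal.toReal_add (hu.sub hv).2.ne hv.2.ne] at h2
  have e : nrm (g - f) = nrm (f - g) := by
    unfold nrm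
    rw [← eLpNorm_neg, neg_sub]
  rw [abs_sub_le_iff]
  constructor
  · linarith [tri hf hg]
  · linarith [tri hg hf]

end

/-! ### The evolution of a solution -/

lemma MemH3.isH1 {f : ℝ → ℝ} (h : MemH3 f) {k : ℕ} (hk : k ≤ 2) :
    IsH1 (iteratedDeriv k f) (iteratedDeriv (k + 1) f) where
  cont := h.contDiff.continuous_iteratedDeriv k (by exact_mod_cast hk)
  memLp := h.memLp k (by omega)
  memLp' := h.memLp (k + 1) (by omega)
  ftc a b := by
    rcases hk.lt_or_eq with hk | rfl
    · have hd : Differentiable ℝ (iteratedDeriv k f) :=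
        h.contDiff.differentiable_iteratedDeriv k (by exact_mod_cast hk)
      have hc : Continuous (iteratedDeriv (k + 1) f) :=
        h.contDiff.continuous_iteratedDeriv (k + 1) (by exact_mod_cast hk)
      refine intervalIntegral.integral_eq_sub_of_hasDerivAt (fun x _ => ?_)
        (hc.intervalIntegrable a b)
      rw [iteratedDeriv_succ]
      exact (hd x).hasDerivAt
    · exact h.integral_third a b

lemma MemH3.isH1_zero {f : ℝ → ℝ} (h : MemH3 f) : IsH1 f (iteratedDeriv 1 f) := by
  simpa using h.isH1 (k := 0) (by norm_num)

namespace IsSolution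

variable {B : ℝ → ℝ → ℝ} {τ : ℝ} {B₀ : ℝ → ℝ}

lemma isH1 (hB : IsSolution B τ B₀) {t : ℝ} (ht : t ∈ Ico 0 τ) {k : ℕ} (hk : k ≤ 2) :
    IsH1 (iteratedDeriv k (B t)) (iteratedDeriv (k + 1) (B t)) :=
  (hB.memH3 t ht).isH1 hk

lemma tendsto_nrm_sub (hB : IsSolution B τ B₀) {t : ℝ} (ht : t ∈ Ico 0 τ) {k : ℕ} (hk : k ≤ 3) :
    Tendsto (fun s => nrm (iteratedDeriv k (B s) - iteratedDeriv k (B t))) (𝓝[Ico 0 τ] t)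
      (𝓝 0) := by
  exact (ENNReal.tendsto_toReal ENNReal.zero_ne_top).comp (hB.continuous_H3 t ht k hk)

lemma continuousOn_nrm (hB : IsSolution B τ B₀) {k : ℕ} (hk : k ≤ 3) :
    ContinuousOn (fun t => nrm (iteratedDeriv k (B t))) (Ico 0 τ) := by
  intro t ht
  refine tendsto_iff_norm_sub_tendsto_zero.2 (squeeze_zero' (Eventually.of_forall fun _ =>
    norm_nonneg _) ?_ (hB.tendsto_nrm_sub ht hk))
  filter_upwards [self_mem_nhdsWithin] with s hs
  exact abs_nrm_sub_nrm_le ((hB.memH3 s hs).memLp k hk) ((hB.memH3 t ht).memLp k hk)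

lemma exists_nrm_le (hB : IsSolution B τ B₀) {T : ℝ} (hT : T < τ) :
    ∃ C, ∀ t ∈ Icc 0 T, ∀ k ≤ 3, nrm (iteratedDeriv k (B t)) ≤ C := by
  have hc : ContinuousOn (fun t => ∑ k ∈ Finset.range 4, nrm (iteratedDeriv k (B t))) (Icc 0 T) :=
    continuousOn_finsetSum _ fun k hk =>
      (hB.continuousOn_nrm (by have := Finset.mem_range.1 hk; omega)).mono
        (Icc_subset_Ico_right hT)
  obtain ⟨C, hC⟩ := isCompact_Icc.exists_bound_of_continuousOn hc
  refine ⟨C, fun t ht k hk => ?_⟩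
  have h1 : nrm (iteratedDeriv k (B t)) ≤ ∑ k ∈ Finset.range 4, nrm (iteratedDeriv k (B t)) :=
    Finset.single_le_sum (f := fun k => nrm (iteratedDeriv k (B t))) (fun _ _ => nrm_nonneg _)
      (Finset.mem_range.2 (by omega))
  exact h1.trans ((le_abs_self _).trans (hC t ht))

/-- The modulus of continuity in time of the solution in `H³(ℝ)`, in the form in which it bounds
boundary values of Cauchy integrals. -/
lemma tendsto_modulus (hB : IsSolution B τ B₀) {t : ℝ} (ht : t ∈ Ico 0 τ) {k : ℕ} (hk : k ≤ 2) :
    Tendsto (fun s => 7 * (nrm (iteratedDeriv k (B s) - iteratedDeriv k (B t)) +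
      nrm (iteratedDeriv (k + 1) (B s) - iteratedDeriv (k + 1) (B t)))) (𝓝[Ico 0 τ] t) (𝓝 0) := by
  simpa using ((hB.tendsto_nrm_sub ht (by omega)).add
    (hB.tendsto_nrm_sub ht (show k + 1 ≤ 3 by omega))).const_mul 7

lemma continuousOn_boundaryValue (hB : IsSolution B τ B₀) {k : ℕ} (hk1 : 1 ≤ k) (hk : k ≤ 2) :
    ContinuousOn (fun p : ℝ × ℝ => boundaryValue (iteratedDeriv k (B p.1)) p.2)
      (Ico 0 τ ×ˢ univ) := by
  rintro ⟨t, x⟩ ⟨ht, -⟩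
  simp only at ht
  have hfst : Tendsto (fun p : ℝ × ℝ => p.1) (𝓝[Ico 0 τ ×ˢ univ] (t, x)) (𝓝[Ico 0 τ] t) := by
    rw [nhdsWithin_prod_eq]; exact tendsto_fst
  have hsnd : Tendsto (fun p : ℝ × ℝ => p.2) (𝓝[Ico 0 τ ×ˢ univ] (t, x)) (𝓝 x) :=
    (continuous_snd.tendsto (t, x)).mono_left nhdsWithin_le_nhds
  obtain ⟨j, rfl⟩ : ∃ j, k = j + 1 := ⟨k - 1, by omega⟩
  have hc := continuous_boundaryValue (hB.isH1 ht (k := j) (by omega)) (hB.isH1 ht hk)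
  have h1 := (hB.tendsto_modulus ht hk).comp hfst
  have h2 := (tendsto_iff_norm_sub_tendsto_zero.1 ((hc.tendsto x).comp hsnd))
  refine tendsto_iff_norm_sub_tendsto_zero.2 (squeeze_zero' (Eventually.of_forall fun _ =>
    norm_nonneg _) ?_ (by simpa using h1.add h2))
  filter_upwards [self_mem_nhdsWithin] with p hp
  have hp1 : p.1 ∈ Ico 0 τ := hp.1
  have h3 := norm_boundaryValue_le ((hB.isH1 hp1 hk).sub (hB.isH1 ht hk)) p.2
  rw [boundaryValue_sub (hB.isH1 hp1 hk) (hB.isH1 ht hk)] at h3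
  calc _ = ‖(boundaryValue (iteratedDeriv (j + 1) (B p.1)) p.2 -
        boundaryValue (iteratedDeriv (j + 1) (B t)) p.2) +
        (boundaryValue (iteratedDeriv (j + 1) (B t)) p.2 -
        boundaryValue (iteratedDeriv (j + 1) (B t)) x)‖ := by simp
    _ ≤ _ := (norm_add_le _ _).trans (add_le_add h3 le_rfl)

lemma continuousOn_cauchyOne (hB : IsSolution B τ B₀) {k : ℕ} (hk : k ≤ 2) {z : ℂ}
    (hz : 0 < z.im) :
    ContinuousOn (fun t => cauchyOne (iteratedDeriv k (B t)) z) (Ico 0 τ) := by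
  intro t ht
  refine tendsto_iff_norm_sub_tendsto_zero.2 (squeeze_zero' (Eventually.of_forall fun _ =>
    norm_nonneg _) ?_ (hB.tendsto_modulus ht hk))
  filter_upwards [self_mem_nhdsWithin] with s hs
  rw [← cauchyOne_sub (hB.isH1 hs hk) (hB.isH1 ht hk) hz]
  exact norm_cauchyOne_le ((hB.isH1 hs hk).sub (hB.isH1 ht hk)) hz

lemma lam_eq (hB : IsSolution B τ B₀) {t : ℝ} (ht : t ∈ Ico 0 τ) (x : ℝ) :
    Lam (B t) x = foldedHilbert (iteratedDeriv 1 (B t)) x / Real.pi := by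
  rw [Lam, ← (hB.isH1 ht (k := 1) (by norm_num)).hilbert_eq, iteratedDeriv_one]

lemma lam_deriv_eq (hB : IsSolution B τ B₀) {t : ℝ} (ht : t ∈ Ico 0 τ) (x : ℝ) :
    Lam (deriv (B t)) x = foldedHilbert (iteratedDeriv 2 (B t)) x / Real.pi := by
  rw [Lam, ← (hB.isH1 ht (k := 2) (by norm_num)).hilbert_eq, iteratedDeriv_succ, iteratedDeriv_one]

/-- The equation paired with the kernel `(z - y)⁻¹ ^ 2`. -/
lemma hasDerivAt_cauchyTwo (hB : IsSolution B τ B₀) {t : ℝ} (ht : t ∈ Ioo 0 τ) {z : ℂ}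
    (hz : 0 < z.im) :
    HasDerivAt (fun s => cauchyTwo (B s) z)
      (∫ y : ℝ, ((foldedHilbert (iteratedDeriv 1 (B t)) y / Real.pi *
        (iteratedDeriv 1 (B t) y - 1) : ℝ) : ℂ) * (z - y)⁻¹ ^ 2) t := by
  obtain ⟨T, hT1, hT2⟩ := exists_between ht.2
  obtain ⟨C, hC⟩ := hB.exists_nrm_le hT2
  have hsub : Ioo 0 T ⊆ Ico 0 τ := fun s hs => ⟨hs.1.le, hs.2.trans hT2⟩
  have ck := continuous_inv_sub hz
  have htI : t ∈ Ico 0 τ := Ioo_subset_Ico_self ht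
  have hC0 : 0 ≤ C := (nrm_nonneg _).trans (hC t ⟨ht.1.le, hT1.le⟩ 0 (by norm_num))
  refine (hasDerivAt_integral_of_dominated_loc_of_deriv_le (Ioo_mem_nhds ht.1 hT1)
    (F' := fun s (y : ℝ) => ((foldedHilbert (iteratedDeriv 1 (B s)) y / Real.pi *
        (iteratedDeriv 1 (B s) y - 1) : ℝ) : ℂ) * (z - y)⁻¹ ^ 2)
    (bound := fun y : ℝ => ((5 * C) * (2 * C + 1)) * ‖(z - y)⁻¹‖ ^ 2) ?_ ?_ ?_ ?_ ?_ ?_).2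
  · filter_upwards [Ioo_mem_nhds ht.1 hT1] with s hs
    have := (hB.memH3 s (hsub hs)).contDiff.continuous
    exact Continuous.aestronglyMeasurable (by fun_prop)
  · exact (hB.memH3 t htI).isH1_zero.integrable_mul_inv_sub_sq hz
  · have c1 := (hB.isH1 htI (k := 1) (by norm_num)).cont
    have c2 := (hB.isH1 htI (k := 0) (by norm_num)).continuous_foldedHilbert
      (hB.isH1 htI (k := 1) (by norm_num))
    exact Continuous.aestronglyMeasurable (by fun_prop)
  · refine ae_of_all _ fun y s hs => ?_
    have hsT : s ∈ Icc 0 T := Ioo_subset_Icc_self hs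
    have h1 := hB.isH1 (hsub hs) (k := 1) (by norm_num)
    have b1 := hC s hsT 1 (by norm_num)
    have b2 := hC s hsT 2 (by norm_num)
    rw [norm_mul, norm_pow, Complex.norm_real, norm_mul, norm_div, Real.norm_eq_abs,
      Real.norm_eq_abs, abs_of_pos Real.pi_pos]
    refine mul_le_mul_of_nonneg_right (mul_le_mul ?_ ?_ (norm_nonneg _) (by positivity))
      (by positivity)
    · refine (div_le_self (abs_nonneg _) (by linarith [Real.pi_gt_three])).trans ?_
      linarith [h1.abs_foldedHilbert_le y]
    · refine (norm_sub_le _ _).trans ?_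
      rw [Real.norm_eq_abs, norm_one]
      linarith [h1.abs_le y]
  · exact (integrable_norm_inv_sub_sq hz).const_mul _
  · refine ae_of_all _ fun y s hs => ?_
    obtain ⟨Bt, h1, h2⟩ := hB.equation s ⟨hs.1, hs.2.trans hT2⟩ y
    rw [hB.lam_eq (hsub hs), ← iteratedDeriv_one] at h2
    have : Bt = foldedHilbert (iteratedDeriv 1 (B s)) y / Real.pi *
        (iteratedDeriv 1 (B s) y - 1) := by linear_combination h2
    rw [← this]
    exact h1.ofReal_comp.mul_const _

/-- In the upper half plane the equation becomes complex Burgers: with `C₁`, `C₂` the Cauchy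
integrals of `B_x` and of its derivative `B_xx`, `∂ₜ C₁ = (C₁ / π + i) C₂`. -/
lemma hasDerivAt_cauchyOne (hB : IsSolution B τ B₀) {t : ℝ} (ht : t ∈ Ioo 0 τ) {z : ℂ}
    (hz : 0 < z.im) :
    HasDerivAt (fun s => cauchyOne (iteratedDeriv 1 (B s)) z)
      ((cauchyOne (iteratedDeriv 1 (B t)) z / Real.pi + Complex.I) *
        cauchyOne (iteratedDeriv 2 (B t)) z) t := by
  have htI : t ∈ Ico 0 τ := Ioo_subset_Ico_self ht
  have h1 := hB.isH1 htI (k := 1) (by norm_num)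
  have h2 := hB.isH1 htI (k := 2) (by norm_num)
  have e : (fun s => cauchyOne (iteratedDeriv 1 (B s)) z) =ᶠ[𝓝 t]
      fun s => -cauchyTwo (B s) z := by
    filter_upwards [Ioo_mem_nhds ht.1 ht.2] with s hs
    have hsI := Ioo_subset_Ico_self hs
    exact cauchyOne_eq_neg_cauchyTwo (hB.memH3 s hsI).isH1_zero
      (hB.isH1 hsI (k := 1) (by norm_num)) hz
  refine ((hB.hasDerivAt_cauchyTwo ht hz).neg.congr_of_eventuallyEq e).congr_deriv ?_
  have c2 := (hB.isH1 htI (k := 0) (by norm_num)).continuous_foldedHilbert h1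
  have cf := h1.cont
  have i2 : Integrable fun y : ℝ => (z - y)⁻¹ ^ 2 *
      (foldedHilbert (iteratedDeriv 1 (B t)) y : ℂ) := by
    refine (integrable_inv_sub_sq hz).mul_bdd
      (c := 2 * nrm (iteratedDeriv 1 (B t)) + 3 * nrm (iteratedDeriv 2 (B t)))
      (Continuous.aestronglyMeasurable (by fun_prop)) (ae_of_all _ fun y => ?_)
    simpa using h1.abs_foldedHilbert_le y
  have i1 : Integrable fun y : ℝ => (((iteratedDeriv 1 (B t) y : ℝ) : ℂ) * (z - y)⁻¹ ^ 2) *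
      (foldedHilbert (iteratedDeriv 1 (B t)) y : ℂ) := by
    refine (h1.integrable_mul_inv_sub_sq hz).mul_bdd
      (c := 2 * nrm (iteratedDeriv 1 (B t)) + 3 * nrm (iteratedDeriv 2 (B t)))
      (Continuous.aestronglyMeasurable (by fun_prop)) (ae_of_all _ fun y => ?_)
    simpa using h1.abs_foldedHilbert_le y
  have hpi : (Real.pi : ℂ) ≠ 0 := by exact_mod_cast Real.pi_ne_zero
  have e2 : ∫ y : ℝ, ((foldedHilbert (iteratedDeriv 1 (B t)) y / Real.pi *
        (iteratedDeriv 1 (B t) y - 1) : ℝ) : ℂ) * (z - y)⁻¹ ^ 2 =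
      (Real.pi : ℂ)⁻¹ * (cauchyOne (iteratedDeriv 1 (B t)) z * cauchyTwo (iteratedDeriv 1 (B t)) z -
        -(Complex.I * Real.pi) * cauchyTwo (iteratedDeriv 1 (B t)) z) := by
    rw [← integral_mul_foldedHilbert_mul_inv_sub_sq h1 hz,
      ← integral_inv_sub_sq_mul_foldedHilbert h1 hz, ← integral_sub i1 i2, ← integral_const_mul]
    congr 1; ext y
    push_cast
    ring
  rw [e2, cauchyOne_eq_neg_cauchyTwo h1 h2 hz]
  field_simp
  ring

/-- On the real line the equation becomes complex Burgers, in integrated form. -/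
lemma boundaryValue_sub_eq (hB : IsSolution B τ B₀) {t : ℝ} (ht : t ∈ Ico 0 τ) (x : ℝ) :
    boundaryValue (iteratedDeriv 1 (B t)) x - boundaryValue (iteratedDeriv 1 (B 0)) x =
      ∫ s in (0 : ℝ)..t, (boundaryValue (iteratedDeriv 1 (B s)) x / Real.pi + Complex.I) *
        boundaryValue (iteratedDeriv 2 (B s)) x := by
  have h0 : (0 : ℝ) ∈ Ico 0 τ := ⟨le_rfl, ht.1.trans_lt ht.2⟩
  have hsub : Icc 0 t ⊆ Ico 0 τ := Icc_subset_Ico_right ht.2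
  obtain ⟨C, hC⟩ := hB.exists_nrm_le ht.2
  have hz : ∀ {ε : ℝ}, 0 < ε → 0 < (x + ε * Complex.I : ℂ).im := fun hε => by simpa
  have hcont : ∀ {ε : ℝ}, 0 < ε → ContinuousOn (fun s =>
      (cauchyOne (iteratedDeriv 1 (B s)) (x + ε * Complex.I) / Real.pi + Complex.I) *
        cauchyOne (iteratedDeriv 2 (B s)) (x + ε * Complex.I)) (Icc 0 t) := fun hε =>
    ((((hB.continuousOn_cauchyOne (k := 1) (by norm_num) (hz hε)).div_const _).add
      continuousOn_const).mul
        (hB.continuousOn_cauchyOne (k := 2) (by norm_num) (hz hε))).mono hsub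
  have hftc : ∀ {ε : ℝ}, 0 < ε → (∫ s in (0 : ℝ)..t,
      (cauchyOne (iteratedDeriv 1 (B s)) (x + ε * Complex.I) / Real.pi + Complex.I) *
        cauchyOne (iteratedDeriv 2 (B s)) (x + ε * Complex.I)) =
      cauchyOne (iteratedDeriv 1 (B t)) (x + ε * Complex.I) -
        cauchyOne (iteratedDeriv 1 (B 0)) (x + ε * Complex.I) := fun hε =>
    intervalIntegral.integral_eq_sub_of_hasDerivAt_of_le ht.1
      ((hB.continuousOn_cauchyOne (k := 1) (by norm_num) (hz hε)).mono hsub)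
      (fun s hs => hB.hasDerivAt_cauchyOne ⟨hs.1, hs.2.trans ht.2⟩ (hz hε))
      ((hcont hε).intervalIntegrable_of_Icc ht.1)
  have hbd : ∀ {k : ℕ}, k ≤ 2 → ∀ {s ε : ℝ}, s ∈ Icc 0 t → 0 < ε →
      ‖cauchyOne (iteratedDeriv k (B s)) (x + ε * Complex.I)‖ ≤ 14 * C := by
    intro k hk s ε hs hε
    refine (norm_cauchyOne_le (hB.isH1 (hsub hs) hk) (hz hε)).trans ?_
    linarith [hC s hs k (by omega), hC s hs (k + 1) (by omega)]
  have hlim : ∀ {k : ℕ}, k ≤ 2 → ∀ {s : ℝ}, s ∈ Icc 0 t →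
      Tendsto (fun ε : ℝ => cauchyOne (iteratedDeriv k (B s)) (x + ε * Complex.I)) (𝓝[>] 0)
        (𝓝 (boundaryValue (iteratedDeriv k (B s)) x)) := fun hk s hs =>
    tendsto_cauchyOne (hB.isH1 (hsub hs) hk) x
  have hl1 := (hlim (k := 1) (by norm_num) (right_mem_Icc.2 ht.1)).sub
    (hlim (k := 1) (by norm_num) (left_mem_Icc.2 ht.1))
  have hl2 : Tendsto (fun ε : ℝ => ∫ s in (0 : ℝ)..t,
      (cauchyOne (iteratedDeriv 1 (B s)) (x + ε * Complex.I) / Real.pi + Complex.I) *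
        cauchyOne (iteratedDeriv 2 (B s)) (x + ε * Complex.I)) (𝓝[>] 0)
      (𝓝 (∫ s in (0 : ℝ)..t, (boundaryValue (iteratedDeriv 1 (B s)) x / Real.pi + Complex.I) *
        boundaryValue (iteratedDeriv 2 (B s)) x)) := by
    refine intervalIntegral.tendsto_integral_filter_of_dominated_convergence
      (fun _ => (14 * C + 1) * (14 * C)) ?_ ?_ (by simp) ?_
    · filter_upwards [self_mem_nhdsWithin] with ε hε
      rw [uIoc_of_le ht.1]
      exact ((hcont hε).mono Ioc_subset_Icc_self).aestronglyMeasurable measurableSet_Ioc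
    · filter_upwards [self_mem_nhdsWithin] with ε hε
      refine ae_of_all _ fun s hs => ?_
      rw [uIoc_of_le ht.1] at hs
      have hs' := Ioc_subset_Icc_self hs
      have b1 := hbd (k := 1) (by norm_num) hs' hε
      have hC0 := (norm_nonneg _).trans b1
      rw [norm_mul]
      refine mul_le_mul ((norm_add_le _ _).trans ?_) (hbd (by norm_num) hs' hε) (norm_nonneg _)
        (by linarith)
      rw [Complex.norm_I, norm_div, Complex.norm_real, Real.norm_of_nonneg Real.pi_pos.le]
      have := div_le_self (norm_nonneg (cauchyOne (iteratedDeriv 1 (B s)) (x + ε * Complex.I)))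
        (show 1 ≤ Real.pi by linarith [Real.pi_gt_three])
      linarith
    · refine ae_of_all _ fun s hs => ?_
      rw [uIoc_of_le ht.1] at hs
      have hs' := Ioc_subset_Icc_self hs
      exact (((hlim (k := 1) (by norm_num) hs').div_const _).add_const _).mul
        (hlim (by norm_num) hs')
  refine tendsto_nhds_unique hl1 (hl2.congr' ?_)
  filter_upwards [self_mem_nhdsWithin] with ε hε
  exact hftc hε

end IsSolution

/-! ### Complex Burgers along a real characteristic -/

/-- The bounded coefficient `φ` need not be continuous: at `0` the derivative `φ * m` tends to
`0` because `m` does. -/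
lemma eq_zero_of_hasDerivAt_mul_self {m φ : ℝ → ℂ} {T C : ℝ} (hm : ContinuousOn m (Icc 0 T))
    (hd : ∀ t ∈ Ioo 0 T, HasDerivAt m (φ t * m t) t) (hφ : ∀ t ∈ Ioo 0 T, ‖φ t‖ ≤ C)
    (h0 : m 0 = 0) : ∀ t ∈ Icc 0 T, m t = 0 := by
  rcases le_or_gt T 0 with hT | hT
  · intro t ht
    rwa [le_antisymm (ht.2.trans hT) ht.1]
  have hright : HasDerivWithinAt m 0 (Ici 0) 0 := by
    refine hasDerivWithinAt_Ici_of_tendsto_deriv (s := Ioo 0 T)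
      (fun t ht => (hd t ht).differentiableAt.differentiableWithinAt)
      ((hm 0 ⟨le_rfl, hT.le⟩).mono Ioo_subset_Icc_self) (Ioo_mem_nhdsGT hT) ?_
    have h1 : Tendsto (fun t => C * ‖m t‖) (𝓝[>] 0) (𝓝 0) := by
      have := (hm 0 ⟨le_rfl, hT.le⟩).mono_left (nhdsWithin_le_iff.2 (mem_of_superset
        (Ioo_mem_nhdsGT hT) Ioo_subset_Icc_self))
      simpa [h0] using this.norm.const_mul C
    refine squeeze_zero_norm' ?_ h1
    filter_upwards [Ioo_mem_nhdsGT hT] with t ht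
    rw [(hd t ht).deriv, norm_mul]
    exact mul_le_mul_of_nonneg_right (hφ t ht) (norm_nonneg _)
  refine eq_zero_of_abs_deriv_le_mul_abs_self_of_eq_zero_right (K := C)
    (f' := fun t => if t = 0 then 0 else φ t * m t) hm (fun t ht => ?_) h0 (fun t ht => ?_)
  · rcases ht.1.eq_or_lt with rfl | ht0
    · simpa using hright
    · simpa [ht0.ne'] using (hd t ⟨ht0, ht.2⟩).hasDerivWithinAt
  · rcases ht.1.eq_or_lt with rfl | ht0
    · simp [h0]
    · simp only [ht0.ne', if_false, norm_mul]
      exact mul_le_mul_of_nonneg_right (hφ t ⟨ht0, ht.2⟩) (norm_nonneg _)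

/-- A classical solution `U`, with `x`-derivative `U'`, of the complex Burgers equation
`U_t = U U_x` for real `x` and `t ∈ [0, τ)`, the equation being integrated in time. -/
structure IsBurgers (U U' : ℝ → ℝ → ℂ) (τ : ℝ) : Prop where
  hasDerivAt : ∀ t ∈ Ico 0 τ, ∀ x, HasDerivAt (U t) (U' t x) x
  continuousOn : ContinuousOn (fun p : ℝ × ℝ => U p.1 p.2) (Ico 0 τ ×ˢ univ)
  continuousOn' : ContinuousOn (fun p : ℝ × ℝ => U' p.1 p.2) (Ico 0 τ ×ˢ univ)
  sub_eq : ∀ t ∈ Ico 0 τ, ∀ x, U t x - U 0 x = ∫ s in (0 : ℝ)..t, U s x * U' s x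
  bound : ∀ T < τ, ∃ C, ∀ t ∈ Icc 0 T, ∀ x, ‖U' t x‖ ≤ C

namespace IsBurgers

variable {U U' : ℝ → ℝ → ℂ} {τ : ℝ}

lemma continuousOn_comp (h : IsBurgers U U' τ) {g : ℝ → ℝ} (hg : Continuous g) :
    ContinuousOn (fun t => U t (g t)) (Ico 0 τ) :=
  h.continuousOn.comp (f := fun t => (t, g t)) (by fun_prop) (fun t ht => ⟨ht, mem_univ _⟩)

lemma continuousOn_comp' (h : IsBurgers U U' τ) {g : ℝ → ℝ} (hg : Continuous g) :
    ContinuousOn (fun t => U' t (g t)) (Ico 0 τ) :=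
  h.continuousOn'.comp (f := fun t => (t, g t)) (by fun_prop) (fun t ht => ⟨ht, mem_univ _⟩)

lemma hasDerivAt_time (h : IsBurgers U U' τ) {t : ℝ} (ht : t ∈ Ioo 0 τ) (x : ℝ) :
    HasDerivAt (fun s => U s x) (U t x * U' t x) t := by
  have hc : ContinuousOn (fun s => U s x * U' s x) (Ico 0 τ) :=
    (h.continuousOn_comp continuous_const).mul (h.continuousOn_comp' continuous_const)
  have e : (fun s => U s x) =ᶠ[𝓝 t] fun s => U 0 x + ∫ r in (0 : ℝ)..s, U r x * U' r x := by
    filter_upwards [Ioo_mem_nhds ht.1 ht.2] with s hs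
    rw [← h.sub_eq s (Ioo_subset_Ico_self hs)]
    ring
  refine HasDerivAt.congr_of_eventuallyEq (HasDerivAt.const_add _ ?_) e
  refine intervalIntegral.integral_hasDerivAt_right
    ((hc.mono (Icc_subset_Ico_right ht.2)).intervalIntegrable_of_Icc ht.1.le)
    ((hc.mono Ioo_subset_Ico_self).stronglyMeasurableAtFilter isOpen_Ioo t ht)
    (hc.continuousAt (Ico_mem_nhds ht.1 ht.2))

/-- The derivative of `U` in a frame moving with real speed `-c`. -/
lemma hasDerivAt_moving (h : IsBurgers U U' τ) {t : ℝ} (ht : t ∈ Ioo 0 τ) (c y : ℝ) :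
    HasDerivAt (fun s => U s (y - c * s)) (U' t (y - c * t) * (U t (y - c * t) - c)) t := by
  have hmem : ∀ x : ℝ, Ico 0 τ ×ˢ univ ∈ 𝓝 (t, x) := fun x =>
    prod_mem_nhds (Ico_mem_nhds ht.1 ht.2) univ_mem
  have c1 := h.continuousOn.continuousAt (hmem (y - c * t))
  have c2 := h.continuousOn'.continuousAt (hmem (y - c * t))
  have hI : ∀ᶠ v : ℝ × ℝ in 𝓝 (t, y - c * t), v.1 ∈ Ioo 0 τ :=
    continuous_fst.continuousAt.eventually (Ioo_mem_nhds ht.1 ht.2)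
  have key := hasStrictFDerivAt_uncurry_coprod (𝕜 := ℝ) (u := (t, y - c * t)) (f := U)
    (f₁ := fun s x => ContinuousLinearMap.toSpanSingleton ℝ (U s x * U' s x))
    (f₂ := fun s x => ContinuousLinearMap.toSpanSingleton ℝ (U' s x))
    (hI.mono fun v hv => (h.hasDerivAt_time hv v.2).hasFDerivAt)
    (hI.mono fun v hv => (h.hasDerivAt v.1 (Ioo_subset_Ico_self hv) v.2).hasFDerivAt)
    ((ContinuousLinearMap.toSpanSingletonCLE (𝕜 := ℝ)
      (E := ℂ)).continuous.continuousAt.comp (c1.mul c2))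
    ((ContinuousLinearMap.toSpanSingletonCLE (𝕜 := ℝ)
      (E := ℂ)).continuous.continuousAt.comp c2)
  have hline : HasDerivAt (fun s : ℝ => (s, y - c * s)) ((1 : ℝ), -c) t :=
    (hasDerivAt_id t).prodMk (by simpa using ((hasDerivAt_id t).const_mul c).const_sub y)
  refine (key.hasFDerivAt.comp_hasDerivAt t hline).congr_deriv ?_
  simp [Function.HasUncurry.uncurry]
  ring

variable {x₀ c : ℝ}

/-- A point where the initial value is real is carried along a straight line in the real axis, on
which `U` is constant. -/
lemma eq_const (h : IsBurgers U U' τ) (hc : U 0 x₀ = c) {t : ℝ} (ht : t ∈ Ico 0 τ) :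
    U t (x₀ - c * t) = c := by
  obtain ⟨C, hC⟩ := h.bound t ht.2
  have := eq_zero_of_hasDerivAt_mul_self (m := fun s => U s (x₀ - c * s) - c)
    (φ := fun s => U' s (x₀ - c * s)) (T := t) (C := C)
    (((h.continuousOn_comp (by fun_prop)).sub continuousOn_const).mono
      (Icc_subset_Ico_right ht.2))
    (fun s hs => (h.hasDerivAt_moving ⟨hs.1, hs.2.trans ht.2⟩ c x₀).sub_const _)
    (fun s hs => hC s (Ioo_subset_Icc_self hs) _) (by simp [hc]) t (right_mem_Icc.2 ht.1)
  exact sub_eq_zero.1 this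

/-- Along the characteristic the slope satisfies the Riccati equation, in integrated form. Only one
`x`-derivative of `U` is available, so the equation is obtained as the limit of the equations for
difference quotients. -/
lemma riccati (h : IsBurgers U U' τ) (hc : U 0 x₀ = c) {t : ℝ} (ht : t ∈ Ico 0 τ) :
    U' t (x₀ - c * t) - U' 0 x₀ = ∫ s in (0 : ℝ)..t, U' s (x₀ - c * s) ^ 2 := by
  obtain ⟨C, hC⟩ := h.bound t ht.2
  have hsub : Icc 0 t ⊆ Ico 0 τ := Icc_subset_Ico_right ht.2
  have h0 : (0 : ℝ) ∈ Icc 0 t := left_mem_Icc.2 ht.1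
  have ht' : t ∈ Icc 0 t := right_mem_Icc.2 ht.1
  have hC0 : 0 ≤ C := (norm_nonneg _).trans (hC 0 h0 0)
  have hcont : ∀ y, ContinuousOn (fun s => U' s (y - c * s) * (U s (y - c * s) - c)) (Icc 0 t) :=
    fun y => ((h.continuousOn_comp' (by fun_prop)).mul
      ((h.continuousOn_comp (by fun_prop)).sub continuousOn_const)).mono hsub
  have hquot : ∀ s ∈ Icc 0 t, Tendsto
      (fun η : ℝ => (η : ℂ)⁻¹ * (U s (x₀ + η - c * s) - c)) (𝓝[≠] 0)
      (𝓝 (U' s (x₀ - c * s))) := by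
    intro s hs
    have := hasDerivAt_iff_tendsto_slope_zero.1 (h.hasDerivAt s (hsub hs) (x₀ - c * s))
    refine this.congr fun η => ?_
    rw [h.eq_const hc (hsub hs), Complex.real_smul, Complex.ofReal_inv]
    ring_nf
  have hftc : ∀ η : ℝ, (η : ℂ)⁻¹ * (U t (x₀ + η - c * t) - c) -
      (η : ℂ)⁻¹ * (U 0 (x₀ + η - c * 0) - c) =
      ∫ s in (0 : ℝ)..t, U' s (x₀ + η - c * s) * ((η : ℂ)⁻¹ * (U s (x₀ + η - c * s) - c)) := by
    intro η
    have := intervalIntegral.integral_eq_sub_of_hasDerivAt_of_le ht.1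
      ((h.continuousOn_comp (g := fun s => x₀ + η - c * s) (by fun_prop)).mono hsub)
      (fun s hs => h.hasDerivAt_moving ⟨hs.1, hs.2.trans ht.2⟩ c (x₀ + η))
      ((hcont (x₀ + η)).intervalIntegrable_of_Icc ht.1)
    rw [← mul_sub, sub_sub_sub_cancel_right, ← this, ← intervalIntegral.integral_const_mul]
    congr 1; ext s; ring
  have hx : ∀ s ∈ Icc 0 t, ∀ η : ℝ, ‖(η : ℂ)⁻¹ * (U s (x₀ + η - c * s) - c)‖ ≤ C := by
    intro s hs η
    have h1 := Convex.norm_image_sub_le_of_norm_hasDerivWithin_le (f := U s) (s := univ)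
      (fun x _ => (h.hasDerivAt s (hsub hs) x).hasDerivWithinAt) (fun x _ => hC s hs x)
      convex_univ (mem_univ (x₀ - c * s)) (mem_univ (x₀ + η - c * s))
    rw [h.eq_const hc (hsub hs), show x₀ + η - c * s - (x₀ - c * s) = η by ring] at h1
    rw [norm_mul, norm_inv, Complex.norm_real]
    rcases eq_or_ne η 0 with rfl | hη
    · simpa using hC0
    · rw [inv_mul_le_iff₀ (norm_pos_iff.2 hη)]
      linarith
  have l1 := (hquot t ht').sub (hquot 0 h0)
  rw [show x₀ - c * 0 = x₀ by ring] at l1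
  refine tendsto_nhds_unique (l1.congr hftc) ?_
  refine intervalIntegral.tendsto_integral_filter_of_dominated_convergence
    (fun _ => C * C) ?_ ?_ (by simp) ?_
  · refine Eventually.of_forall fun η => ?_
    rw [uIoc_of_le ht.1]
    refine ContinuousOn.aestronglyMeasurable (((h.continuousOn_comp' (by fun_prop)).mul
      (continuousOn_const.mul ((h.continuousOn_comp (by fun_prop)).sub
        continuousOn_const))).mono (Ioc_subset_Icc_self.trans hsub)) measurableSet_Ioc
  · refine Eventually.of_forall fun η => ae_of_all _ fun s hs => ?_
    rw [uIoc_of_le ht.1] at hs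
    have hs' := Ioc_subset_Icc_self hs
    rw [norm_mul]
    exact mul_le_mul (hC s hs' _) (hx s hs' η) (norm_nonneg _) hC0
  · refine ae_of_all _ fun s hs => ?_
    rw [uIoc_of_le ht.1] at hs
    have hs' := Ioc_subset_Icc_self hs
    have hU' : Continuous fun x => U' s x := by
      rw [← continuousOn_univ]
      exact h.continuousOn'.comp (f := fun x => (s, x)) (by fun_prop)
        (fun x _ => ⟨hsub hs', mem_univ _⟩)
    have l2 : Tendsto (fun η : ℝ => U' s (x₀ + η - c * s)) (𝓝[≠] 0) (𝓝 (U' s (x₀ - c * s))) := by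
      have : Continuous fun η : ℝ => U' s (x₀ + η - c * s) := by fun_prop
      simpa using (this.tendsto 0).mono_left nhdsWithin_le_nhds
    simpa only [sq] using l2.mul (hquot s hs')

lemma slope_mul_eq (h : IsBurgers U U' τ) (hc : U 0 x₀ = c) {a : ℝ} (ha : U' 0 x₀ = a) {t : ℝ}
    (ht : t ∈ Ico 0 τ) : U' t (x₀ - c * t) * (1 - t * a) = a := by
  obtain ⟨C, hC⟩ := h.bound t ht.2
  have hq := h.continuousOn_comp' (g := fun t => x₀ - c * t) (by fun_prop)
  have hd : ∀ s ∈ Ioo 0 τ, HasDerivAt (fun s => U' s (x₀ - c * s)) (U' s (x₀ - c * s) ^ 2) s := by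
    intro s hs
    have e : (fun s => U' s (x₀ - c * s)) =ᶠ[𝓝 s]
        fun s => U' 0 x₀ + ∫ r in (0 : ℝ)..s, U' r (x₀ - c * r) ^ 2 := by
      filter_upwards [Ioo_mem_nhds hs.1 hs.2] with r hr
      rw [← h.riccati hc (Ioo_subset_Ico_self hr)]
      ring
    refine HasDerivAt.congr_of_eventuallyEq (HasDerivAt.const_add _ ?_) e
    exact intervalIntegral.integral_hasDerivAt_right
      (((hq.pow 2).mono (Icc_subset_Ico_right hs.2)).intervalIntegrable_of_Icc hs.1.le)
      (((hq.pow 2).mono Ioo_subset_Ico_self).stronglyMeasurableAtFilter isOpen_Ioo s hs)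
      ((hq.pow 2).continuousAt (Ico_mem_nhds hs.1 hs.2))
  -- `m = q (1 - a s) - a` satisfies the linear equation `m' = q m`
  have := eq_zero_of_hasDerivAt_mul_self
    (m := fun s => U' s (x₀ - c * s) * (1 - s * a) - a)
    (φ := fun s => U' s (x₀ - c * s)) (T := t) (C := C)
    (((hq.mul (by fun_prop)).sub continuousOn_const).mono (Icc_subset_Ico_right ht.2))
    (fun s hs => by
      have d : HasDerivAt (fun s : ℝ => (1 : ℂ) - s * a) (-a) s := by
        simpa using ((Complex.ofRealCLM.hasDerivAt (x := s)).mul_const (a : ℂ)).const_sub 1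
      refine (((hd s ⟨hs.1, hs.2.trans ht.2⟩).mul d).sub_const _).congr_deriv ?_
      ring)
    (fun s hs => hC s (Ioo_subset_Icc_self hs) _) (by simp [ha]) t (right_mem_Icc.2 ht.1)
  exact sub_eq_zero.1 this

end IsBurgers

/-! ### Blow-up -/

namespace IsSolution

variable {B : ℝ → ℝ → ℝ} {τ : ℝ} {B₀ : ℝ → ℝ}

lemma isBurgers (hB : IsSolution B τ B₀) :
    IsBurgers (fun t x => boundaryValue (iteratedDeriv 1 (B t)) x / Real.pi + Complex.I)
      (fun t x => boundaryValue (iteratedDeriv 2 (B t)) x / Real.pi) τ where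
  hasDerivAt t ht x :=
    ((hasDerivAt_boundaryValue (hB.isH1 ht (k := 1) (by norm_num))
      (hB.isH1 ht (k := 2) (by norm_num)) x).div_const _).add_const _
  continuousOn := ((hB.continuousOn_boundaryValue le_rfl (by norm_num)).div_const _).add
    continuousOn_const
  continuousOn' := (hB.continuousOn_boundaryValue (by norm_num) le_rfl).div_const _
  sub_eq t ht x := by
    rw [add_sub_add_right_eq_sub, ← sub_div, hB.boundaryValue_sub_eq ht,
      ← intervalIntegral.integral_div]
    congr 1; ext s; ring
  bound T hT := by
    obtain ⟨C, hC⟩ := hB.exists_nrm_le hT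
    refine ⟨14 * C, fun t ht x => ?_⟩
    rw [norm_div, Complex.norm_real, Real.norm_of_nonneg Real.pi_pos.le]
    refine (div_le_self (norm_nonneg _) (by linarith [Real.pi_gt_three])).trans ?_
    refine (norm_boundaryValue_le (hB.isH1 (Icc_subset_Ico_right hT ht) le_rfl) x).trans ?_
    linarith [hC t ht 2 (by norm_num), hC t ht 3 le_rfl]

lemma boundaryValue_one (hB : IsSolution B τ B₀) {t : ℝ} (ht : t ∈ Ico 0 τ) (x : ℝ) :
    boundaryValue (iteratedDeriv 1 (B t)) x / Real.pi + Complex.I =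
      Lam (B t) x - Complex.I * (deriv (B t) x - 1) := by
  have hpi : (Real.pi : ℂ) ≠ 0 := by exact_mod_cast Real.pi_ne_zero
  rw [hB.lam_eq ht, boundaryValue, iteratedDeriv_one]
  push_cast
  field_simp
  ring

lemma boundaryValue_two (hB : IsSolution B τ B₀) {t : ℝ} (ht : t ∈ Ico 0 τ) (x : ℝ) :
    boundaryValue (iteratedDeriv 2 (B t)) x / Real.pi =
      Lam (deriv (B t)) x - Complex.I * deriv (deriv (B t)) x := by
  have hpi : (Real.pi : ℂ) ≠ 0 := by exact_mod_cast Real.pi_ne_zero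
  rw [hB.lam_deriv_eq ht, boundaryValue, iteratedDeriv_succ, iteratedDeriv_one]
  push_cast
  field_simp

variable {x₀ : ℝ}

/-- The trajectory is a straight line, as `ΛB` is constant along it. -/
lemma isTrajectory_line (hB : IsSolution B τ B₀) (hτ : 0 < τ) (h1 : deriv B₀ x₀ = 1) :
    IsTrajectory B τ x₀ (fun t => x₀ - Lam B₀ x₀ * t) where
  initial := by simp
  ode t ht := by
    have h0 : (0 : ℝ) ∈ Ico 0 τ := ⟨le_rfl, hτ⟩
    have := hB.isBurgers.eq_const (x₀ := x₀) (c := Lam B₀ x₀)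
      (by rw [hB.boundaryValue_one h0, hB.initial, h1]; simp) ht
    rw [hB.boundaryValue_one ht] at this
    have := congrArg Complex.re this
    simp at this
    rw [this]
    simpa using (((hasDerivAt_id t).const_mul (Lam B₀ x₀)).const_sub x₀).hasDerivWithinAt

lemma hasDerivAt_lam (hB : IsSolution B τ B₀) {t : ℝ} (ht : t ∈ Ico 0 τ) (x : ℝ) :
    HasDerivAt (Lam (B t)) (Lam (deriv (B t)) x) x := by
  rw [show Lam (B t) = _ from funext (hB.lam_eq ht), hB.lam_deriv_eq ht]
  exact ((hB.isH1 ht (k := 1) (by norm_num)).hasDerivAt_foldedHilbert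
    (hB.isH1 ht (k := 2) (by norm_num)) x).div_const _

lemma trajectory_unique (hB : IsSolution B τ B₀) {X Y : ℝ → ℝ} (hX : IsTrajectory B τ x₀ X)
    (hY : IsTrajectory B τ x₀ Y) : EqOn X Y (Ico 0 τ) := by
  intro t ht
  have hsub : Icc 0 t ⊆ Ico 0 τ := Icc_subset_Ico_right ht.2
  obtain ⟨C, hC⟩ := hB.isBurgers.bound t ht.2
  have hlip : ∀ s ∈ Ico 0 t, LipschitzOnWith C.toNNReal (fun x => -Lam (B s) x) univ := by
    intro s hs
    refine convex_univ.lipschitzOnWith_of_nnnorm_hasDerivWithin_le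
      (fun x _ => (hB.hasDerivAt_lam (hsub (Ico_subset_Icc_self hs)) x).neg.hasDerivWithinAt)
      (fun x _ => ?_)
    have h1 := hC s (Ico_subset_Icc_self hs) x
    rw [hB.boundaryValue_two (hsub (Ico_subset_Icc_self hs))] at h1
    have h2 := (Complex.abs_re_le_norm _).trans h1
    simp at h2
    rw [← NNReal.coe_le_coe, coe_nnnorm, norm_neg]
    exact h2.trans (Real.le_coe_toNNReal C)
  have hd : ∀ {Z : ℝ → ℝ}, IsTrajectory B τ x₀ Z →
      ContinuousOn Z (Icc 0 t) ∧
      ∀ s ∈ Ico 0 t, HasDerivWithinAt Z (-Lam (B s) (Z s)) (Ici s) s := fun hZ =>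
    ⟨fun s hs => ((hZ.ode s (hsub hs)).continuousWithinAt).mono hsub,
      fun s hs => (hZ.ode s (hsub (Ico_subset_Icc_self hs))).mono_of_mem_nhdsWithin
        (Ico_mem_nhdsGE_of_mem (hsub (Ico_subset_Icc_self hs)))⟩
  exact ODE_solution_unique_of_mem_Icc_right (v := fun s x => -Lam (B s) x) (s := fun _ => univ)
    hlip (hd hX).1 (hd hX).2 (fun _ _ => mem_univ _) (hd hY).1 (hd hY).2 (fun _ _ => mem_univ _)
    (hX.initial.trans hY.initial.symm) (right_mem_Icc.2 ht.1)

lemma lam_deriv_trajectory_mul (hB : IsSolution B τ B₀) (hτ : 0 < τ) (h1 : deriv B₀ x₀ = 1)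
    (h2 : deriv (deriv B₀) x₀ = 0) {X : ℝ → ℝ} (hX : IsTrajectory B τ x₀ X) {t : ℝ}
    (ht : t ∈ Ico 0 τ) :
    Lam (deriv (B t)) (X t) * (1 - t * Lam (deriv B₀) x₀) = Lam (deriv B₀) x₀ := by
  have h0 : (0 : ℝ) ∈ Ico 0 τ := ⟨le_rfl, hτ⟩
  have := hB.isBurgers.slope_mul_eq (x₀ := x₀) (c := Lam B₀ x₀) (a := Lam (deriv B₀) x₀)
    (by rw [hB.boundaryValue_one h0, hB.initial, h1]; simp)
    (by rw [hB.boundaryValue_two h0, hB.initial, h2]; simp) ht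
  rw [hB.boundaryValue_two ht] at this
  have := congrArg Complex.re this
  rw [hB.trajectory_unique hX (hB.isTrajectory_line hτ h1) ht]
  simpa using this

end IsSolution

end EMHD

theorem theorem1p3 (B₀ : ℝ → ℝ) (hL2 : MemLp B₀ 2 volume) (hC3 : ContDiff ℝ 3 B₀)
    (x₀ : ℝ) (h1 : deriv B₀ x₀ = 1) (h2 : deriv (deriv B₀) x₀ = 0)
    (h3 : 0 < EMHD.Lam (deriv B₀) x₀)
    (τ : ℝ) (hτ : 0 < τ) (B : ℝ → ℝ → ℝ) (hB : EMHD.IsSolution B τ B₀) :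
    τ ≤ 1 / EMHD.Lam (deriv B₀) x₀ ∧
    (∃ X : ℝ → ℝ, EMHD.IsTrajectory B τ x₀ X) ∧
    (∀ X : ℝ → ℝ, EMHD.IsTrajectory B τ x₀ X →
      (∀ t ∈ Ico 0 τ, EMHD.Lam (deriv (B t)) (X t) =
        EMHD.Lam (deriv B₀) x₀ / (1 - t * EMHD.Lam (deriv B₀) x₀)) ∧
      (∀ t ∈ Ioo 0 τ, HasDerivAt (fun s => EMHD.Lam (deriv (B s)) (X s))
        (EMHD.Lam (deriv (B t)) (X t) ^ 2) t) ∧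
      (τ = 1 / EMHD.Lam (deriv B₀) x₀ →
        Tendsto (fun t => EMHD.Lam (deriv (B t)) (X t)) (𝓝[<] τ) atTop)) := by
  set a := EMHD.Lam (deriv B₀) x₀ with ha
  have hmul : ∀ {X : ℝ → ℝ}, EMHD.IsTrajectory B τ x₀ X → ∀ t ∈ Ico 0 τ,
      EMHD.Lam (deriv (B t)) (X t) * (1 - t * a) = a := fun hX t ht =>
    hB.lam_deriv_trajectory_mul hτ h1 h2 hX ht
  have hX₀ := hB.isTrajectory_line hτ h1
  have hne : ∀ t ∈ Ico 0 τ, 1 - t * a ≠ 0 := fun t ht h0 => by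
    have := hmul hX₀ t ht
    rw [h0, mul_zero] at this
    exact h3.ne this
  have hτa : τ ≤ 1 / a := by
    by_contra! hlt
    exact hne (1 / a) ⟨by positivity, hlt⟩ (by field_simp; ring)
  refine ⟨hτa, ⟨_, hX₀⟩, fun X hX => ?_⟩
  have hform : ∀ t ∈ Ico 0 τ, EMHD.Lam (deriv (B t)) (X t) = a / (1 - t * a) := fun t ht =>
    eq_div_of_mul_eq (hne t ht) (hmul hX t ht)
  refine ⟨hform, fun t ht => ?_, fun hτeq => ?_⟩
  · have e : (fun s => EMHD.Lam (deriv (B s)) (X s)) =ᶠ[𝓝 t] fun s => a / (1 - s * a) := by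
      filter_upwards [Ioo_mem_nhds ht.1 ht.2] with s hs
      exact hform s (Ioo_subset_Ico_self hs)
    have htI := Ioo_subset_Ico_self ht
    have d : HasDerivAt (fun s : ℝ => 1 - s * a) (-a) t := by
      simpa using ((hasDerivAt_id t).mul_const a).const_sub 1
    refine (((hasDerivAt_const t a).div d (hne t htI)).congr_of_eventuallyEq e).congr_deriv ?_
    rw [hform t htI, div_pow]
    ring
  · have e : (fun t => EMHD.Lam (deriv (B t)) (X t)) =ᶠ[𝓝[<] τ] fun t => a * (1 - t * a)⁻¹ := by
      filter_upwards [Ioo_mem_nhdsLT hτ] with t ht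
      rw [hform t (Ioo_subset_Ico_self ht), div_eq_mul_inv]
    refine Tendsto.congr' e.symm (Tendsto.const_mul_atTop h3 (tendsto_inv_nhdsGT_zero.comp ?_))
    have hτ1 : 1 - τ * a = 0 := by rw [hτeq]; field_simp; ring
    refine tendsto_nhdsWithin_iff.2 ⟨?_, ?_⟩
    · have : Continuous fun t : ℝ => 1 - t * a := by fun_prop
      simpa [hτ1] using (this.tendsto τ).mono_left (nhdsWithin_le_nhds (s := Iio τ))
    · filter_upwards [self_mem_nhdsWithin] with t ht
      have := mul_lt_mul_of_pos_right (mem_Iio.1 ht) h3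
      rw [mem_Ioi]
      linarith
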